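/- Let $N\ge 0$ be an integer. Consider the space $V_N$ of plane curves $S^1=\mathbb R/2\pi\mathbb Z\to\mathbb R^2$ of the form $$x(\varphi)=a_0+\sum_{j=1}^N (a_j\cos j\varphi+b_j\sin j\varphi),\qquad y(\varphi)=\tilde a_0+\sum_{j=1}^N(\tilde a_j\cos j\varphi+\tilde b_j\sin j\varphi)$$ with real coefficients, supplied with the $L_2$ norm $\|f\|^2=\frac1\pi\int_0^{2\pi}\bigl(x(\varphi)^2+y(\varphi)^2\bigr)\,d\varphi$ for $f=(x,y)$. Let $P$ be a probability distribution on $V_N\times V_N$ that has an integrable density with respect to the Lebesgue measure of the coefficients, and suppose that this density depends only on $\max(\|f\|,\|g\|)$. Then for $P$-almost every pair $(f,g)$ the two curves have finitely many intersection points, and their number, counted as points of $f(S^1)\cap g(S^1)$, equals the number of pairs $(\varphi,\psi)\in S^1\times S^1$ with $f(\varphi)=g(\psi)$. This number is $P$-integrable, and its average with respect to $P$ is equal to $$\frac{2^{8N+3}\,((2N)!)^4}{((4N+1)!)^2}\,\bigl(1+4+\cdots+N^2\bigr),$$ where the sum $1+4+\cdots+N^2$ is $0$ for $N=0$. -/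

import Mathlib

open MeasureTheory Set

noncomputable section

/-- Coefficients of a plane trigonometric curve of degree at most `N`, one family for each of the
two coordinates `x` (index `0`) and `y` (index `1`): in each family `Sum.inl j` is the coefficient
of `cos (j φ)` for `0 ≤ j ≤ N` and `Sum.inr j` is the coefficient of `sin ((j + 1) φ)` for
`0 ≤ j < N`. The canonical measure `volume` on this space is the Lebesgue measure of the
coefficients; it is a constant multiple of the Euclidean volume of the `L₂` inner product. -/
abbrev TrigCurve (N : ℕ) : Type := Fin 2 → (Fin (N + 1) ⊕ Fin N) → ℝ

namespace TrigCurve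

/-- The `2π`-periodic parametrized plane curve with the given coefficients. -/
def eval {N : ℕ} (c : TrigCurve N) (φ : ℝ) : Fin 2 → ℝ := fun i =>
  ∑ j : Fin (N + 1), c i (Sum.inl j) * Real.cos ((j : ℕ) * φ) +
    ∑ j : Fin N, c i (Sum.inr j) * Real.sin (((j : ℕ) + 1) * φ)

/-- The `L₂` norm: the square root of `(1 / π) ∫₀^{2π} (x(φ)² + y(φ)²) dφ`. -/
def l2Norm {N : ℕ} (c : TrigCurve N) : ℝ :=
  Real.sqrt (1 / Real.pi *
    ∫ φ in (0 : ℝ)..(2 * Real.pi), ((c.eval φ 0) ^ 2 + (c.eval φ 1) ^ 2))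

/-- The points of the plane that lie on both curves. -/
def intersectionPoints {N : ℕ} (p : TrigCurve N × TrigCurve N) : Set (Fin 2 → ℝ) :=
  range p.1.eval ∩ range p.2.eval

/-- The pairs of parameters `(φ, ψ)` of the two source circles, each circle being represented by
`[0, 2π)`, at which the two curves meet. -/
def intersectionParams {N : ℕ} (p : TrigCurve N × TrigCurve N) : Set (ℝ × ℝ) :=
  {t | t.1 ∈ Ico 0 (2 * Real.pi) ∧ t.2 ∈ Ico 0 (2 * Real.pi) ∧ p.1.eval t.1 = p.2.eval t.2}

/-- The function on pairs of curves that is the given function `h` of the maximum of the two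
`L₂` norms. -/
def maxNormDensity (N : ℕ) (h : ℝ → ℝ) (p : TrigCurve N × TrigCurve N) : ℝ :=
  h (max p.1.l2Norm p.2.l2Norm)

/-- The distribution on pairs of curves with density `maxNormDensity N h`. -/
def maxNormLaw (N : ℕ) (h : ℝ → ℝ) : Measure (TrigCurve N × TrigCurve N) :=
  (volume : Measure (TrigCurve N × TrigCurve N)).withDensity
    (fun p => ENNReal.ofReal (maxNormDensity N h p))

end TrigCurve

end

/-! The proof is a Kac–Rice computation. The number of meeting parameter pairs is unchanged when
`(f, g)` is scaled by a positive factor, so all densities in the maximal norm give the same mean,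
and it suffices to integrate the count over the product of two unit balls
(`map_maxNorm_withDensity_incidenceCount`).

Translating `g` by constant curves and applying the area formula to `(φ, ψ) ↦ f φ - g ψ` turns the
count into an integral over the torus of `|det (f' φ, g' ψ)|` on the subspace `f φ = g ψ`
(`lintegral_incidenceCount_mul`). In coefficient space, evaluation at `φ` and the derivative at `φ`
are given by vectors that are orthogonal for the dual weighted inner product, with squared norms `κ
= N + 1/2` and `S = 1 + 4 + ⋯ + N²` independent of `φ`. Hence the integrand over the torus is
constant, and the torus contributes only its area `(2π)²`.

For a common value `y`, the curves of the unit ball with `f φ = y` form a ball of squared radius `1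
- |y|²/κ` in a space of dimension `4N`. The determinant has degree one in each curve, so each ball
contributes a power `(4N+1)/2` of that radius squared (`setLIntegral_kernelSq_lt`). The constants
are found by comparing balls with Gaussians (`lintegral_mul_exp_neg_of_sublevel`), for which the
determinant of two independent planar vectors has an explicit mean. Integrating over `y` and using
Legendre's duplication formula gives the stated number (`lintegral_lintegral_incidence`,
`kacRice_constant`).

Finiteness almost everywhere follows from this integrability. Parameter pairs and points are
equinumerous because almost surely neither curve passes through a double point of the other: such
coincidences form a three-parameter family in a four-dimensional space of perturbations
(`ae_notMem_doublePointIncidence`). -/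

/-! ### Haar measure along the fibres of a linear map. -/

section Disintegration

variable {E W : Type*} [NormedAddCommGroup E] [NormedSpace ℝ E] [MeasurableSpace E] [BorelSpace E]
  [FiniteDimensional ℝ E] [NormedAddCommGroup W] [NormedSpace ℝ W] [MeasurableSpace W]
  [BorelSpace W] [FiniteDimensional ℝ W] {μ : Measure E} [μ.IsAddHaarMeasure]
  {ν : Measure W} [ν.IsAddHaarMeasure]

open scoped ENNReal

/-- Disintegration of a Haar measure along the fibres of a linear map with a linear section. -/
theorem lintegral_eq_lintegral_lintegral_fiber {L : E →L[ℝ] W} {s : W →L[ℝ] E}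
    (hs : ∀ y, L (s y) = y) {ρ : W → ℝ≥0∞} (hρ : Measurable ρ) (hρ1 : ∫⁻ y, ρ y ∂ν = 1)
    {G : E → ℝ≥0∞} (hG : Measurable G) :
    ∫⁻ f, G f ∂μ = ∫⁻ y, ∫⁻ f, ρ (L f) * G (f + s (y - L f)) ∂μ ∂ν := by
  symm
  calc ∫⁻ y, ∫⁻ f, ρ (L f) * G (f + s (y - L f)) ∂μ ∂ν
      = ∫⁻ f, ∫⁻ y, ρ (L f) * G (f + s (y - L f)) ∂ν ∂μ := by
        apply lintegral_lintegral_swap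
        apply Measurable.aemeasurable
        fun_prop
    _ = ∫⁻ f, ∫⁻ y, ρ (L f) * G (f + s y) ∂ν ∂μ := by
        congr with f
        exact lintegral_sub_right_eq_self (fun y => ρ (L f) * G (f + s y)) (L f)
    _ = ∫⁻ y, ∫⁻ f, ρ (L f) * G (f + s y) ∂μ ∂ν := by
        apply lintegral_lintegral_swap
        apply Measurable.aemeasurable
        fun_prop
    -- The translation by `s y` moves the dependence on `y` entirely into `ρ`, whose mass is one.
    _ = ∫⁻ y, ∫⁻ f, ρ (L f - y) * G f ∂μ ∂ν := by
        congr with y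
        rw [← lintegral_add_right_eq_self (fun f => ρ (L f - y) * G f) (s y)]
        simp [hs]
    _ = ∫⁻ f, ∫⁻ y, ρ (L f - y) * G f ∂ν ∂μ := by
        apply lintegral_lintegral_swap
        apply Measurable.aemeasurable
        fun_prop
    _ = ∫⁻ f, G f ∂μ := by
        congr with f
        rw [lintegral_mul_const _ (by fun_prop), lintegral_sub_left_eq_self ρ, hρ1, one_mul]

/-- The fibre integral does not depend on the transverse density and on the section. -/
theorem lintegral_fiber_congr {L : E →L[ℝ] W} {s t : W →L[ℝ] E}
    (hs : ∀ y, L (s y) = y) (ht : ∀ y, L (t y) = y) {ρ σ : W → ℝ≥0∞} (hρ : Measurable ρ)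
    (hρ1 : ∫⁻ y, ρ y ∂ν = 1) (hσ : Measurable σ) (hσ1 : ∫⁻ y, σ y ∂ν = 1)
    {G : E → ℝ≥0∞} (hG : Measurable G) (y : W) :
    ∫⁻ f, ρ (L f) * G (f + s (y - L f)) ∂μ = ∫⁻ f, σ (L f) * G (f + t (y - L f)) ∂μ := by
  -- Disintegrating with the other density and section makes the mass of `ρ` split off as a factor.
  rw [lintegral_eq_lintegral_lintegral_fiber (μ := μ) (ν := ν) ht hσ hσ1 (by fun_prop)]
  calc ∫⁻ z, ∫⁻ f, σ (L f) * (ρ (L (f + t (z - L f))) *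
          G (f + t (z - L f) + s (y - L (f + t (z - L f))))) ∂μ ∂ν
      = ∫⁻ z, ∫⁻ f, ρ z * (σ (L f) * G (f + t (z - L f) + s (y - z))) ∂μ ∂ν := by
        congr with z
        congr with f
        simp only [map_add, ht, add_sub_cancel]
        ring
    _ = ∫⁻ z, ρ z * ∫⁻ f, σ (L f) * G (f + t (y - L f)) ∂μ ∂ν := by
        congr with z
        rw [lintegral_const_mul _ (by fun_prop)]
        congr 1
        -- The two sections differ by a vector of the kernel of `L`, which translation invariance
        -- absorbs.
        rw [← lintegral_add_right_eq_self (fun f => σ (L f) * G (f + t (y - L f)))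
          (s (y - z) - t (y - z))]
        congr with f
        have e₁ : L (f + (s (y - z) - t (y - z))) = L f := by simp only [map_add, map_sub L, hs, ht]; simp
        have e₂ : f + (s (y - z) - t (y - z)) + t (y - L f) = f + t (z - L f) + s (y - z) := by
          simp only [map_sub]; abel
        rw [e₁, e₂]
    _ = _ := by rw [lintegral_mul_const _ hρ, hρ1, one_mul]

/-- Taking `y = L f` in `hQq` gives `Q = q + r ∘ L`, so `exp (-Q)` has an image under `L`
proportional to `exp (-r)`. The cross-multiplied form avoids dividing by masses that may be zero or
infinite. -/
theorem lintegral_marginal_exp_mul {L : E →L[ℝ] W} {s : W →L[ℝ] E}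
    (hs : ∀ y, L (s y) = y) {Q q : E → ℝ} {r : W → ℝ} (hQ : Measurable Q)
    (hr : Measurable r)
    (hQq : ∀ f y, Q (f + s (y - L f)) = q f + r y) {ρ : W → ℝ≥0∞} (hρ : Measurable ρ)
    (hρ1 : ∫⁻ y, ρ y ∂ν = 1) {φ : W → ℝ≥0∞} (hφ : Measurable φ) :
    (∫⁻ f, φ (L f) * ENNReal.ofReal (Real.exp (-Q f)) ∂μ) *
        ∫⁻ y, ENNReal.ofReal (Real.exp (-r y)) ∂ν =
      (∫⁻ f, ENNReal.ofReal (Real.exp (-Q f)) ∂μ) *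
        ∫⁻ y, φ y * ENNReal.ofReal (Real.exp (-r y)) ∂ν := by
  have hq : q = fun f => Q (f + s (0 - L f)) - r 0 := by
    ext f; rw [hQq]; ring
  have hqm : Measurable q := by rw [hq]; fun_prop
  have key : ∀ φ : W → ℝ≥0∞, Measurable φ →
      ∫⁻ f, φ (L f) * ENNReal.ofReal (Real.exp (-Q f)) ∂μ =
        (∫⁻ f, ρ (L f) * ENNReal.ofReal (Real.exp (-q f)) ∂μ) *
          ∫⁻ y, φ y * ENNReal.ofReal (Real.exp (-r y)) ∂ν := by
    intro φ hφ
    rw [lintegral_eq_lintegral_lintegral_fiber (μ := μ) (ν := ν) hs hρ hρ1 (by fun_prop),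
      ← lintegral_const_mul _ (by fun_prop)]
    congr with y
    rw [← lintegral_mul_const _ (by fun_prop)]
    congr with f
    rw [hQq, map_add, hs, add_sub_cancel, neg_add, Real.exp_add,
      ENNReal.ofReal_mul (Real.exp_pos _).le]
    ring
  have h1 := key (fun _ => 1) measurable_const
  simp only [one_mul] at h1
  rw [key φ hφ, h1]
  ring

end Disintegration

/-! ### From sublevel sets to exponential weights. -/

section LayerCake

open scoped ENNReal

/-- Write `exp (-q)` as the integral of `exp (-t)` over `t > q` and exchange the integrals; the
powers of `t` then integrate to a Gamma value. This is the bridge between balls and Gaussians. -/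
theorem lintegral_mul_exp_neg_of_sublevel {E : Type*} [MeasurableSpace E] {μ : Measure E}
    [SFinite μ] {Φ : E → ℝ≥0∞} (hΦ : Measurable Φ) {q : E → ℝ} (hq : Measurable q)
    (hq0 : ∀ f, 0 ≤ q f) {p : ℝ} (hp : -1 < p) {A : ℝ≥0∞}
    (h : ∀ t : ℝ, 0 < t → ∫⁻ f in {f | q f < t}, Φ f ∂μ = ENNReal.ofReal (t ^ p) * A) :
    ∫⁻ f, Φ f * ENNReal.ofReal (Real.exp (-q f)) ∂μ =
      ENNReal.ofReal (Real.Gamma (p + 1)) * A := by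
  have hexp : ∀ f, ENNReal.ofReal (Real.exp (-q f)) =
      ∫⁻ t in Ioi (0 : ℝ), {t | q f < t}.indicator (fun t => ENNReal.ofReal (Real.exp (-t))) t := by
    intro f
    have : {t | q f < t} = Ioi (q f) := rfl
    rw [this, setLIntegral_indicator measurableSet_Ioi,
      inter_eq_left.2 (Ioi_subset_Ioi (hq0 f)), ← integral_exp_neg_Ioi,
      ofReal_integral_eq_lintegral_ofReal (integrableOn_exp_neg_Ioi _)
        (Filter.Eventually.of_forall fun t => (Real.exp_pos _).le)]
  have hmeas : MeasurableSet {x : E × ℝ | q x.1 < x.2} :=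
    measurableSet_lt (by fun_prop) (by fun_prop)
  have hind : Measurable (fun x : E × ℝ => Φ x.1 *
      {t | q x.1 < t}.indicator (fun t => ENNReal.ofReal (Real.exp (-t))) x.2) := by
    refine Measurable.mul (by fun_prop) ?_
    exact Measurable.indicator (f := fun x : E × ℝ => ENNReal.ofReal (Real.exp (-x.2)))
      (by fun_prop) hmeas
  calc ∫⁻ f, Φ f * ENNReal.ofReal (Real.exp (-q f)) ∂μ
      = ∫⁻ f, ∫⁻ t in Ioi (0 : ℝ), Φ f *
          {t | q f < t}.indicator (fun t => ENNReal.ofReal (Real.exp (-t))) t ∂volume ∂μ := by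
        congr with f
        rw [hexp, lintegral_const_mul]
        exact Measurable.indicator (by fun_prop) measurableSet_Ioi
    _ = ∫⁻ t in Ioi (0 : ℝ), ∫⁻ f, Φ f *
          {t | q f < t}.indicator (fun t => ENNReal.ofReal (Real.exp (-t))) t ∂μ ∂volume :=
        lintegral_lintegral_swap hind.aemeasurable
    _ = ∫⁻ t in Ioi (0 : ℝ), ENNReal.ofReal (Real.exp (-t) * t ^ (p + 1 - 1)) * A := by
        refine setLIntegral_congr_fun measurableSet_Ioi fun t ht => ?_
        have ht' : (0 : ℝ) < t := ht
        have : ∀ f, Φ f * {t | q f < t}.indicator (fun t => ENNReal.ofReal (Real.exp (-t))) t =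
            ENNReal.ofReal (Real.exp (-t)) * {f | q f < t}.indicator Φ f := by
          intro f
          by_cases hf : q f < t <;> simp [indicator, hf, mul_comm]
        simp only [this]
        rw [lintegral_const_mul _ (hΦ.indicator (measurableSet_lt hq measurable_const)),
          lintegral_indicator (measurableSet_lt hq measurable_const), h t ht',
          ENNReal.ofReal_mul (Real.exp_pos _).le, add_sub_cancel_right, mul_assoc]
    _ = _ := by
        rw [lintegral_mul_const _ (by fun_prop), Real.Gamma_eq_integral (by linarith),
          ofReal_integral_eq_lintegral_ofReal (Real.GammaIntegral_convergent (by linarith))]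
        filter_upwards [ae_restrict_mem measurableSet_Ioi] with t ht
        have ht' : (0 : ℝ) < t := ht
        positivity

end LayerCake

/-! ### The area formula with multiplicities in equal dimensions. -/

section AreaFormula

open scoped ENNReal Function NNReal

variable {E : Type*} [NormedAddCommGroup E] [NormedSpace ℝ E] [FiniteDimensional ℝ E]
  [MeasurableSpace E] [BorelSpace E] (μ : Measure E) [μ.IsAddHaarMeasure]

/-- On small pieces `F` differs from an invertible linear map by a Lipschitz error below the
reciprocal of the norm of the inverse, which forces injectivity. -/
theorem exists_partition_injOn_of_det_ne_zero {F : E → E} {F' : E → E →L[ℝ] E} {s : Set E}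
    (hF : ∀ x ∈ s, HasFDerivWithinAt F (F' x) s x) (hdet : ∀ x ∈ s, (F' x).det ≠ 0) :
    ∃ t : ℕ → Set E, Pairwise (Disjoint on t) ∧ (∀ n, MeasurableSet (t n)) ∧
      s ⊆ ⋃ n, t n ∧ ∀ n, InjOn F (s ∩ t n) := by
  classical
  have hr : ∀ A : E →L[ℝ] E, ∃ r : ℝ≥0, r ≠ 0 ∧ (A.det ≠ 0 → ∀ u : Set E,
      ApproximatesLinearOn F A u r → InjOn F u) := by
    intro A
    by_cases hA : A.det = 0
    · exact ⟨1, one_ne_zero, fun h => absurd hA h⟩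
    · set B := A.toContinuousLinearEquivOfDetNeZero hA with hB
      have hBA : (B : E →L[ℝ] E) = A := by ext; simp [hB]
      rcases subsingleton_or_nontrivial E with hE | hE
      · exact ⟨1, one_ne_zero, fun _ u _ => Set.injOn_of_subsingleton F u⟩
      · have hpos : 0 < ‖(B.symm : E →L[ℝ] E)‖₊ := B.nnnorm_symm_pos
        refine ⟨‖(B.symm : E →L[ℝ] E)‖₊⁻¹ / 2, by positivity, fun _ u hu => ?_⟩
        rw [← hBA] at hu
        exact hu.injOn (Or.inr (NNReal.half_lt_self (by positivity)))
  choose r hr0 hr using hr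
  obtain ⟨t, A, hd, hm, hst, happ, hA⟩ :=
    exists_partition_approximatesLinearOn_of_hasFDerivWithinAt F s F' hF r hr0
  refine ⟨t, hd, hm, hst, fun n => ?_⟩
  rcases s.eq_empty_or_nonempty with rfl | hne
  · simp
  · obtain ⟨y, hy, hAy⟩ := hA hne n
    exact hr (A n) (hAy ▸ hdet y hy) _ (happ n)

theorem encard_eq_tsum_indicator_image {X Y : Type*} {F : X → Y} {s : Set X} {t : ℕ → Set X}
    (hd : Pairwise (Disjoint on t)) (hst : s ⊆ ⋃ n, t n) (hinj : ∀ n, InjOn F (s ∩ t n)) (y : Y) :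
    (({x | x ∈ s ∧ F x = y}.encard : ℕ∞) : ℝ≥0∞) =
      ∑' n, (F '' (s ∩ t n)).indicator (fun _ => (1 : ℝ≥0∞)) y := by
  -- With every set measurable, countable additivity of the counting measure is available without
  -- conditions.
  let _ : MeasurableSpace X := ⊤
  have hcount : ∀ u : Set X, ((u.encard : ℕ∞) : ℝ≥0∞) = Measure.count u := fun u =>
    (Measure.count_apply (MeasurableSpace.measurableSet_top)).symm
  have hU : {x | x ∈ s ∧ F x = y} = ⋃ n, {x | x ∈ s ∩ t n ∧ F x = y} := by
    ext x
    simp only [mem_ofPred_eq, mem_iUnion, mem_inter_iff]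
    constructor
    · rintro ⟨h1, h2⟩
      obtain ⟨n, hn⟩ := mem_iUnion.1 (hst h1)
      exact ⟨n, ⟨h1, hn⟩, h2⟩
    · rintro ⟨n, ⟨h1, _⟩, h2⟩
      exact ⟨h1, h2⟩
  rw [hcount, hU, measure_iUnion]
  · congr with n
    rw [← hcount]
    by_cases hy : y ∈ F '' (s ∩ t n)
    · obtain ⟨x, hx, rfl⟩ := hy
      rw [indicator_of_mem (mem_image_of_mem F hx)]
      have : {x' | x' ∈ s ∩ t n ∧ F x' = F x} = {x} := by
        ext x'
        simp only [mem_ofPred_eq, mem_singleton_iff]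
        exact ⟨fun h => hinj n h.1 hx h.2, by rintro rfl; exact ⟨hx, rfl⟩⟩
      rw [this]; simp
    · rw [indicator_of_notMem hy]
      have : {x' | x' ∈ s ∩ t n ∧ F x' = y} = ∅ := by
        ext x'
        simp only [mem_ofPred_eq, mem_empty_iff_false, iff_false, not_and]
        exact fun h1 h2 => hy ⟨x', h1, h2⟩
      rw [this]; simp
  · intro i j hij
    refine Set.disjoint_left.2 fun x hx hx' => ?_
    exact Set.disjoint_left.1 (hd hij) hx.1.2 hx'.1.2
  · exact fun _ => MeasurableSpace.measurableSet_top

/-- The area formula, with multiplicities. -/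
theorem lintegral_encard_fiber_mul {F : E → E} {F' : E → E →L[ℝ] E} {s : Set E}
    (hs : MeasurableSet s) (hF : ∀ x, HasFDerivAt F (F' x) x) (hF' : Measurable F')
    {k : E → ℝ≥0∞} (hk : Measurable k) :
    ∫⁻ y, (({x | x ∈ s ∧ F x = y}.encard : ℕ∞) : ℝ≥0∞) * k y ∂μ =
      ∫⁻ x in s, ENNReal.ofReal |(F' x).det| * k (F x) ∂μ := by
  have hdet : Measurable fun x => (F' x).det :=
    (ContinuousLinearMap.continuous_det.measurable).comp hF'
  set s₀ := s ∩ {x | (F' x).det = 0} with hs₀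
  set s₁ := s ∩ {x | (F' x).det ≠ 0} with hs₁
  have hm0 : MeasurableSet {x | (F' x).det = 0} := hdet (measurableSet_singleton 0)
  have hm1 : MeasurableSet {x | (F' x).det ≠ 0} := hm0.compl
  have hs₁m : MeasurableSet s₁ := hs.inter hm1
  obtain ⟨t, hd, hm, hst, hinj⟩ := exists_partition_injOn_of_det_ne_zero (F := F) (F' := F')
    (s := s₁) (fun x _ => (hF x).hasFDerivWithinAt) (fun x hx => hx.2)
  -- By Sard's theorem critical points can be dropped from the count; in the other integral they
  -- carry the factor zero.
  have hnull : μ (F '' s₀) = 0 :=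
    addHaar_image_eq_zero_of_det_fderivWithin_eq_zero μ
      (fun x _ => (hF x).hasFDerivWithinAt) (fun x hx => hx.2)
  have himg : ∀ n, MeasurableSet (F '' (s₁ ∩ t n)) := fun n =>
    measurable_image_of_fderivWithin (hs₁m.inter (hm n))
      (fun x _ => (hF x).hasFDerivWithinAt) (hinj n)
  calc ∫⁻ y, (({x | x ∈ s ∧ F x = y}.encard : ℕ∞) : ℝ≥0∞) * k y ∂μ
      = ∫⁻ y, ∑' n, (F '' (s₁ ∩ t n)).indicator k y ∂μ := by
        refine lintegral_congr_ae ?_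
        filter_upwards [measure_eq_zero_iff_ae_notMem.1 hnull] with y hy
        have : {x | x ∈ s ∧ F x = y} = {x | x ∈ s₁ ∧ F x = y} := by
          ext x
          simp only [mem_ofPred_eq, hs₁, mem_inter_iff]
          constructor
          · rintro ⟨h1, h2⟩
            exact ⟨⟨h1, fun h0 => hy ⟨x, ⟨h1, h0⟩, h2⟩⟩, h2⟩
          · rintro ⟨⟨h1, _⟩, h2⟩
            exact ⟨h1, h2⟩
        rw [this, encard_eq_tsum_indicator_image hd hst hinj, ← ENNReal.tsum_mul_right]
        congr with n
        by_cases h : y ∈ F '' (s₁ ∩ t n) <;> simp [indicator, h]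
    _ = ∑' n, ∫⁻ y in F '' (s₁ ∩ t n), k y ∂μ := by
        rw [lintegral_tsum fun n => (hk.indicator (himg n)).aemeasurable]
        congr with n
        rw [lintegral_indicator (himg n)]
    _ = ∑' n, ∫⁻ x in s₁ ∩ t n, ENNReal.ofReal |(F' x).det| * k (F x) ∂μ := by
        congr with n
        exact lintegral_image_eq_lintegral_abs_det_fderiv_mul μ (hs₁m.inter (hm n))
          (fun x _ => (hF x).hasFDerivWithinAt) (hinj n) k
    _ = ∫⁻ x in s₁, ENNReal.ofReal |(F' x).det| * k (F x) ∂μ := by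
        rw [← lintegral_iUnion (fun n => hs₁m.inter (hm n)), ← inter_iUnion,
          inter_eq_left.2 hst]
        exact fun i j hij => (hd hij).mono inter_subset_right inter_subset_right
    _ = ∫⁻ x in s, ENNReal.ofReal |(F' x).det| * k (F x) ∂μ := by
        rw [hs₁, inter_comm, ← Measure.restrict_restrict hm1,
          ← lintegral_indicator (μ := μ.restrict s) hm1]
        congr with x
        by_cases h : (F' x).det = 0 <;> simp [indicator, h]

end AreaFormula

/-! ### Measurability of the number of points in a fibre. -/

section CountingMeasurable

open scoped ENNReal

theorem IsClosed.setOf_exists_mem_compact {X T : Type*} [TopologicalSpace X] [TopologicalSpace T]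
    {K : Set T} (hK : IsCompact K) {C : Set (X × T)} (hC : IsClosed C) :
    IsClosed {x | ∃ t ∈ K, (x, t) ∈ C} := by
  have : CompactSpace K := isCompact_iff_compactSpace.1 hK
  have h := isClosedMap_fst_of_compactSpace (X := X) (Y := K) _
    (hC.preimage (f := fun p : X × K => (p.1, (p.2 : T))) (by fun_prop))
  convert h using 1
  ext x
  simp only [mem_ofPred_eq, mem_image, Prod.exists, mem_preimage]
  constructor
  · rintro ⟨t, ht, h⟩
    exact ⟨x, ⟨t, ht⟩, h, rfl⟩
  · rintro ⟨y, t, h, rfl⟩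
    exact ⟨t, t.2, h⟩

theorem natCast_le_encard_iff {T : Type*} {A : Set T} {k : ℕ} :
    (k : ℕ∞) ≤ A.encard ↔ ∃ t : Fin k → T, Function.Injective t ∧ ∀ i, t i ∈ A := by
  constructor
  · intro h
    obtain ⟨B, hBA, hB⟩ := exists_subset_encard_eq h
    have hfin : B.Finite := finite_of_encard_eq_coe hB
    have hcard : hfin.toFinset.card = k := by
      rw [hfin.encard_eq_coe_toFinset_card] at hB
      exact_mod_cast hB
    let e := (hfin.toFinset.equivFinOfCardEq hcard).symm
    exact ⟨fun i => e i, fun i j hij => e.injective (Subtype.ext hij),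
      fun i => hBA (hfin.mem_toFinset.1 (e i).2)⟩
  · rintro ⟨t, ht, hA⟩
    calc (k : ℕ∞) = (range t).encard := by rw [← image_univ, ht.encard_image]; simp
      _ ≤ A.encard := encard_le_encard (by rintro _ ⟨i, rfl⟩; exact hA i)

/-- The number of points of a fibre of a closed relation over a σ-compact set is measurable. -/
theorem measurable_encard_fiber {X T : Type*} [TopologicalSpace X] [MeasurableSpace X]
    [BorelSpace X] [MetricSpace T] {K : ℕ → Set T} (hK : ∀ m, IsCompact (K m)) (hmono : Monotone K)
    {C : Set (X × T)} (hC : IsClosed C) :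
    Measurable fun x => (({t | t ∈ ⋃ m, K m ∧ (x, t) ∈ C}.encard : ℕ∞) : ℝ≥0∞) := by
  have hle : ∀ k : ℕ, MeasurableSet {x | (k : ℕ∞) ≤ {t | t ∈ ⋃ m, K m ∧ (x, t) ∈ C}.encard} := by
    intro k
    -- Having `k` distinct points is not a closed condition, but having `k` points of `K m` at
    -- mutual distances at least `1 / (m + 1)` is, and it projects along a compact set.
    have : {x | (k : ℕ∞) ≤ {t | t ∈ ⋃ m, K m ∧ (x, t) ∈ C}.encard} =
        ⋃ m : ℕ, {x | ∃ t ∈ univ.pi fun _ : Fin k => K m, (x, t) ∈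
          {p : X × (Fin k → T) | (∀ i j, i ≠ j → 1 / ((m : ℝ) + 1) ≤ dist (p.2 i) (p.2 j)) ∧
            ∀ i, (p.1, p.2 i) ∈ C}} := by
      ext x
      simp only [natCast_le_encard_iff, mem_ofPred_eq, mem_iUnion, mem_univ_pi]
      constructor
      · rintro ⟨t, hinj, ht⟩
        choose m hm using fun i => (ht i).1
        have hd : ∀ i j, ∃ M : ℕ, i ≠ j → 1 / ((M : ℝ) + 1) < dist (t i) (t j) := by
          intro i j
          by_cases hij : i = j
          · exact ⟨0, fun h => absurd hij h⟩
          · obtain ⟨M, hM⟩ := exists_nat_one_div_lt (dist_pos.2 (hinj.ne hij))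
            exact ⟨M, fun _ => hM⟩
        choose M hM using hd
        refine ⟨(∑ i, m i) + ∑ i, ∑ j, M i j, t, fun i => ?_, fun i j hij => ?_, fun i => (ht i).2⟩
        · refine hmono ?_ (hm i)
          exact (Finset.single_le_sum (f := m) (fun _ _ => Nat.zero_le _)
            (Finset.mem_univ i)).trans (Nat.le_add_right _ _)
        · refine le_trans ?_ (hM i j hij).le
          have h1 : M i j ≤ (∑ i, m i) + ∑ i, ∑ j, M i j :=
            ((Finset.single_le_sum (f := fun j => M i j) (fun _ _ => Nat.zero_le _)
              (Finset.mem_univ j)).trans (Finset.single_le_sum (f := fun i => ∑ j, M i j)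
              (fun _ _ => Nat.zero_le _) (Finset.mem_univ i))).trans (Nat.le_add_left _ _)
          have h2 : (M i j : ℝ) ≤ (((∑ i, m i) + ∑ i, ∑ j, M i j : ℕ) : ℝ) := by exact_mod_cast h1
          gcongr
      · rintro ⟨m, t, ht, hd, hC⟩
        refine ⟨t, fun i j hij => ?_, fun i => ⟨⟨m, ht i⟩, hC i⟩⟩
        by_contra hne
        have := hd i j hne
        rw [hij, dist_self] at this
        have : (0 : ℝ) < 1 / ((m : ℝ) + 1) := by positivity
        linarith
    rw [this]
    refine MeasurableSet.iUnion fun m => IsClosed.measurableSet ?_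
    refine IsClosed.setOf_exists_mem_compact (isCompact_univ_pi fun _ => hK m) ?_
    simp only [ofPred_and, ofPred_forall]
    refine IsClosed.inter (isClosed_iInter fun i => isClosed_iInter fun j =>
      isClosed_iInter fun _ => isClosed_le (by fun_prop) (by fun_prop)) (isClosed_iInter fun i => ?_)
    exact hC.preimage (f := fun p : X × (Fin k → T) => (p.1, p.2 i)) (by fun_prop)
  have hm : Measurable fun x => {t | t ∈ ⋃ m, K m ∧ (x, t) ∈ C}.encard := by
    refine ENat.measurable_iff.2 fun n => ?_
    convert (hle n).diff (hle (n + 1)) using 1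
    ext x
    simp only [mem_preimage, mem_singleton_iff, mem_sdiff, mem_ofPred_eq, not_le]
    generalize {t | t ∈ ⋃ m, K m ∧ (x, t) ∈ C}.encard = a
    push_cast
    rw [ENat.lt_add_one_iff (ENat.natCast_ne_top n)]
    exact ⟨fun h => ⟨h.ge, h.le⟩, fun h => le_antisymm h.2 h.1⟩
  exact Measurable.of_discrete.comp hm

end CountingMeasurable

/-! ### Radial and Gaussian integrals in the plane. -/

section PlanarIntegrals

open scoped ENNReal

/-- Finiteness is required on half-lines only, because the push-forwards of Lebesgue measure by
norms have infinite total mass. -/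
theorem MeasureTheory.Measure.ext_of_Iio_of_ne_top {μ ν : Measure ℝ} (hfin : ∀ t, μ (Iio t) ≠ ∞)
    (h : ∀ t, μ (Iio t) = ν (Iio t)) : μ = ν := by
  refine Measure.ext_of_Ico' μ ν (fun a b _ => ne_top_of_le_ne_top (hfin b)
    (measure_mono fun x hx => hx.2)) fun a b hab => ?_
  have hI : Ico a b = Iio b \ Iio a := by
    ext x; simp
  rw [hI, measure_sdiff (Iio_subset_Iio hab.le) measurableSet_Iio.nullMeasurableSet (hfin a),
    measure_sdiff (Iio_subset_Iio hab.le) measurableSet_Iio.nullMeasurableSet (h a ▸ hfin a), h, h]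

/-- The square of the Euclidean norm of a vector of the plane. -/
def planeSq (y : Fin 2 → ℝ) : ℝ := y 0 ^ 2 + y 1 ^ 2

@[fun_prop]
theorem continuous_planeSq : Continuous planeSq := by unfold planeSq; fun_prop

theorem planeSq_nonneg (y : Fin 2 → ℝ) : 0 ≤ planeSq y := by unfold planeSq; positivity

theorem volume_planeSq_lt (t : ℝ) :
    volume {y | planeSq y < t} = ENNReal.ofReal Real.pi * ENNReal.ofReal t := by
  rw [← Complex.volume_preserving_equiv_pi.measure_preimage
    (measurableSet_lt (by fun_prop) (by fun_prop)).nullMeasurableSet]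
  have : (Complex.measurableEquivPi ⁻¹' {y | planeSq y < t}) = Metric.ball (0 : ℂ) (Real.sqrt t) := by
    ext z
    simp only [mem_preimage, mem_ofPred_eq, planeSq, Complex.measurableEquivPi_apply,
      Metric.mem_ball, dist_zero_right, Matrix.cons_val_zero, Matrix.cons_val_one]
    rw [Real.lt_sqrt (norm_nonneg z), Complex.sq_norm, Complex.normSq_apply, sq, sq]
  rw [this, Complex.volume_ball, mul_comm, ← ENNReal.ofReal_pow (Real.sqrt_nonneg t)]
  congr 1
  · rw [← NNReal.coe_real_pi, ENNReal.ofReal_coe_nnreal]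
  · rcases le_total 0 t with ht | ht
    · rw [Real.sq_sqrt ht]
    · rw [Real.sqrt_eq_zero_of_nonpos ht, ENNReal.ofReal_of_nonpos ht]; simp

/-- Polar coordinates: a disc of squared radius `t` has area `π t`, so the squared radius is
distributed as `π` times Lebesgue measure on the half-line. -/
theorem lintegral_comp_planeSq {g : ℝ → ℝ≥0∞} (hg : Measurable g) :
    ∫⁻ y, g (planeSq y) = ENNReal.ofReal Real.pi * ∫⁻ t in Ioi (0 : ℝ), g t := by
  have : Measure.map planeSq volume = ENNReal.ofReal Real.pi • volume.restrict (Ioi 0) := by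
    have hval : ∀ t, Measure.map planeSq volume (Iio t) =
        ENNReal.ofReal Real.pi * ENNReal.ofReal t := fun t => by
      rw [Measure.map_apply (by fun_prop) measurableSet_Iio]
      exact volume_planeSq_lt t
    refine Measure.ext_of_Iio_of_ne_top (fun t => ?_) fun t => ?_
    · rw [hval]; exact ENNReal.mul_ne_top ENNReal.ofReal_ne_top ENNReal.ofReal_ne_top
    · rw [hval, Measure.smul_apply, Measure.restrict_apply measurableSet_Iio, inter_comm,
        Ioi_inter_Iio, Real.volume_Ioo, sub_zero, smul_eq_mul]
  rw [← lintegral_map hg (by fun_prop), this, lintegral_smul_measure, smul_eq_mul]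

theorem lintegral_one_sub_planeSq_div_pow {κ : ℝ} (hκ : 0 < κ) (m : ℕ) :
    ∫⁻ y in {y | planeSq y < κ}, ENNReal.ofReal ((1 - planeSq y / κ) ^ m) =
      ENNReal.ofReal (Real.pi * κ / (m + 1)) := by
  rw [← lintegral_indicator (measurableSet_lt (by fun_prop) (by fun_prop))]
  have h1 : ∀ y, {y | planeSq y < κ}.indicator
      (fun y => ENNReal.ofReal ((1 - planeSq y / κ) ^ m)) y =
      (Iio κ).indicator (fun t => ENNReal.ofReal ((1 - t / κ) ^ m)) (planeSq y) := fun y => rfl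
  simp only [h1]
  rw [lintegral_comp_planeSq (Measurable.indicator (by fun_prop) measurableSet_Iio),
    setLIntegral_indicator measurableSet_Iio, inter_comm, Ioi_inter_Iio, mul_div_assoc,
    ENNReal.ofReal_mul Real.pi_pos.le, ← ofReal_integral_eq_lintegral_ofReal]
  · congr 2
    rw [← integral_Ioc_eq_integral_Ioo, ← intervalIntegral.integral_of_le hκ.le]
    have : ∀ t ∈ uIcc 0 κ, HasDerivAt (fun t : ℝ => -(κ / (m + 1)) * (1 - t / κ) ^ (m + 1))
        ((1 - t / κ) ^ m) t := by
      intro t _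
      have h : HasDerivAt (fun t : ℝ => 1 - t / κ) (-(1 / κ)) t :=
        ((hasDerivAt_id' t).div_const κ).const_sub 1
      refine ((h.fun_pow (m + 1)).const_mul (-(κ / (m + 1)))).congr_deriv ?_
      push_cast
      field_simp
    rw [intervalIntegral.integral_eq_sub_of_hasDerivAt this
      (Continuous.intervalIntegrable (by fun_prop) _ _)]
    simp [hκ.ne']
  · exact (Continuous.integrableOn_Icc (by fun_prop)).mono_set Ioo_subset_Icc_self
  · filter_upwards [ae_restrict_mem measurableSet_Ioo] with t ht
    have : t / κ < 1 := (div_lt_one hκ).2 ht.2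
    exact pow_nonneg (by linarith) _

theorem lintegral_rpow_mul_exp_neg_mul_Ioi {a r : ℝ} (ha : 0 < a) (hr : 0 < r) :
    ∫⁻ t in Ioi (0 : ℝ), ENNReal.ofReal (t ^ (a - 1) * Real.exp (-(r * t))) =
      ENNReal.ofReal ((1 / r) ^ a * Real.Gamma a) := by
  rw [← Real.integral_rpow_mul_exp_neg_mul_Ioi ha hr, ofReal_integral_eq_lintegral_ofReal]
  · have := integrableOn_rpow_mul_exp_neg_mul_rpow (p := 1) (s := a - 1) (b := r) (by linarith)
      one_pos hr
    simpa [Real.rpow_one, IntegrableOn] using this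
  · filter_upwards [ae_restrict_mem measurableSet_Ioi] with t ht
    have ht' : (0 : ℝ) < t := ht
    positivity

theorem lintegral_exp_neg_planeSq_div {S : ℝ} (hS : 0 < S) :
    ∫⁻ y, ENNReal.ofReal (Real.exp (-(planeSq y / S))) = ENNReal.ofReal (Real.pi * S) := by
  rw [lintegral_comp_planeSq (g := fun t => ENNReal.ofReal (Real.exp (-(t / S)))) (by fun_prop),
    ENNReal.ofReal_mul Real.pi_pos.le]
  have := lintegral_rpow_mul_exp_neg_mul_Ioi (a := 1) (r := 1 / S) one_pos (by positivity)
  simp only [sub_self, Real.rpow_zero, one_mul, one_div, inv_inv, Real.rpow_one, Real.Gamma_one,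
    mul_one] at this
  rw [← this]
  simp only [div_eq_inv_mul]

theorem lintegral_sqrt_planeSq_mul_exp {S : ℝ} (hS : 0 < S) :
    ∫⁻ y, ENNReal.ofReal (Real.sqrt (planeSq y) * Real.exp (-(planeSq y / S))) =
      ENNReal.ofReal (Real.pi * (S * Real.sqrt S * (Real.sqrt Real.pi / 2))) := by
  rw [lintegral_comp_planeSq
    (g := fun t => ENNReal.ofReal (Real.sqrt t * Real.exp (-(t / S)))) (by fun_prop),
    ENNReal.ofReal_mul Real.pi_pos.le]
  congr 1
  have := lintegral_rpow_mul_exp_neg_mul_Ioi (a := 1 / 2 + 1) (r := 1 / S) (by norm_num)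
    (by positivity)
  rw [Real.Gamma_add_one (by norm_num), Real.Gamma_one_half_eq, one_div_one_div,
    Real.rpow_add hS, Real.rpow_one, ← Real.sqrt_eq_rpow, add_sub_cancel_right] at this
  simp only [← Real.sqrt_eq_rpow] at this
  have e : S * √S * (√Real.pi / 2) = √S * S * (1 / 2 * √Real.pi) := by ring
  rw [e, ← this]
  simp only [div_eq_inv_mul, mul_one]

theorem lintegral_exp_neg_sq_div {σ : ℝ} (hσ : 0 < σ) :
    ∫⁻ t : ℝ, ENNReal.ofReal (Real.exp (-(t ^ 2 / σ))) =
      ENNReal.ofReal (Real.sqrt (Real.pi * σ)) := by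
  have hi := integrable_exp_neg_mul_sq (b := 1 / σ) (by positivity)
  have h := integral_gaussian (1 / σ)
  rw [div_div_eq_mul_div, div_one] at h
  rw [← h, ofReal_integral_eq_lintegral_ofReal hi (ae_of_all _ fun t => (Real.exp_pos _).le)]
  congr with t
  congr 2; ring

theorem lintegral_abs_mul_exp_neg_sq_div {σ : ℝ} (hσ : 0 < σ) :
    ∫⁻ t : ℝ, ENNReal.ofReal |t| * ENNReal.ofReal (Real.exp (-(t ^ 2 / σ))) =
      ENNReal.ofReal σ := by
  have hi : Integrable fun t : ℝ => |t| * Real.exp (-(1 / σ) * |t| ^ 2) := by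
    have := (integrable_mul_exp_neg_mul_sq (b := 1 / σ) (by positivity)).abs
    simpa [abs_mul, Real.abs_exp] using this
  have h : ∫ t : ℝ, |t| * Real.exp (-(1 / σ) * |t| ^ 2) = σ := by
    rw [integral_comp_abs (f := fun t => t * Real.exp (-(1 / σ) * t ^ 2))]
    have := integral_rpow_mul_exp_neg_mul_rpow (p := 2) (q := 1) (b := 1 / σ) two_pos
      (by norm_num) (by positivity)
    simp only [Real.rpow_one, Real.rpow_two] at this
    rw [this]
    norm_num
    rw [Real.rpow_neg_one, inv_inv]
    ring
  refine Eq.trans ?_ (congrArg ENNReal.ofReal h)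
  rw [ofReal_integral_eq_lintegral_ofReal hi (ae_of_all _ fun t => by positivity)]
  congr with t
  rw [← ENNReal.ofReal_mul (abs_nonneg t), sq_abs]
  congr 3; ring

/-- The determinant of two vectors of the plane. -/
def planeDet (u v : Fin 2 → ℝ) : ℝ := u 0 * v 1 - u 1 * v 0

theorem exists_density (W : Type*) [NormedAddCommGroup W] [MeasurableSpace W] [BorelSpace W]
    [ProperSpace W] (ν : Measure W) [ν.IsAddHaarMeasure] :
    ∃ ρ : W → ℝ≥0∞, Measurable ρ ∧ ∫⁻ y, ρ y ∂ν = 1 := by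
  refine ⟨(Metric.ball 0 1).indicator fun _ => (ν (Metric.ball 0 1))⁻¹,
    measurable_const.indicator measurableSet_ball, ?_⟩
  rw [lintegral_indicator measurableSet_ball, setLIntegral_const]
  exact ENNReal.inv_mul_cancel (Metric.measure_ball_pos ν 0 one_pos).ne' measure_ball_lt_top.ne

/-- The determinant sees only the component of `u` orthogonal to `v`, so its law under the planar
Gaussian is a one-dimensional Gaussian of scale `S |v|²`. -/
theorem lintegral_abs_planeDet_mul_exp {S : ℝ} (hS : 0 < S) (v : Fin 2 → ℝ) :
    ∫⁻ u, ENNReal.ofReal |planeDet u v| * ENNReal.ofReal (Real.exp (-(planeSq u / S))) =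
      ENNReal.ofReal (Real.sqrt Real.pi * S * Real.sqrt S * Real.sqrt (planeSq v)) := by
  by_cases hv : planeSq v = 0
  · have h0 : v 0 = 0 := by unfold planeSq at hv; nlinarith [sq_nonneg (v 0), sq_nonneg (v 1)]
    have h1 : v 1 = 0 := by unfold planeSq at hv; nlinarith [sq_nonneg (v 0), sq_nonneg (v 1)]
    simp [planeDet, h0, h1, hv]
  · have hv0 : 0 < planeSq v := lt_of_le_of_ne (planeSq_nonneg v) (Ne.symm hv)
    let L : (Fin 2 → ℝ) →L[ℝ] ℝ :=
      v 1 • ContinuousLinearMap.proj 0 - v 0 • ContinuousLinearMap.proj 1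
    have hL : ∀ u, L u = planeDet u v := fun u => by simp [L, planeDet]; ring
    -- The spanning vector is orthogonal to `v` and has determinant one with it.
    let s : ℝ →L[ℝ] (Fin 2 → ℝ) :=
      ContinuousLinearMap.toSpanSingleton ℝ ![v 1 / planeSq v, -v 0 / planeSq v]
    have hs : ∀ y, L (s y) = y := fun y => by
      rw [hL]
      simp [s, planeDet]
      field_simp
      unfold planeSq
      ring
    obtain ⟨ρ, hρ, hρ1⟩ := exists_density ℝ volume
    have key := lintegral_marginal_exp_mul (μ := volume) (ν := volume) hs
      (Q := fun u => planeSq u / S) (q := fun u => planeSq u / S - (L u) ^ 2 / (S * planeSq v))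
      (r := fun t => t ^ 2 / (S * planeSq v)) (by fun_prop) (by fun_prop) (fun u y => by
        simp only [hL]
        simp only [s, planeSq, planeDet, Pi.add_apply, ContinuousLinearMap.toSpanSingleton_apply,
          Pi.smul_apply, smul_eq_mul, Matrix.cons_val_zero, Matrix.cons_val_one]
        have : v 0 ^ 2 + v 1 ^ 2 ≠ 0 := hv
        field_simp
        ring) hρ hρ1 (φ := fun t => ENNReal.ofReal |t|) (by fun_prop)
    simp only [hL] at key
    rw [lintegral_exp_neg_sq_div (by positivity), lintegral_abs_mul_exp_neg_sq_div (by positivity),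
      lintegral_exp_neg_planeSq_div hS] at key
    have hpos : 0 < Real.sqrt (Real.pi * (S * planeSq v)) := by positivity
    rw [← ENNReal.mul_left_inj (c := ENNReal.ofReal (Real.sqrt (Real.pi * (S * planeSq v))))
      (by simpa using hpos) ENNReal.ofReal_ne_top, key, ← ENNReal.ofReal_mul (by positivity),
      ← ENNReal.ofReal_mul (by positivity)]
    congr 1
    rw [Real.sqrt_mul Real.pi_pos.le, Real.sqrt_mul hS.le]
    have e1 := Real.mul_self_sqrt Real.pi_pos.le
    have e2 := Real.mul_self_sqrt hS.le
    have e3 := Real.mul_self_sqrt hv0.le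
    calc Real.pi * S * (S * planeSq v) = (√Real.pi * √Real.pi) * S * ((√S * √S) *
        (√(planeSq v) * √(planeSq v))) := by rw [e1, e2, e3]
      _ = _ := by ring

/-- Here `(π S)²` is the mass of the two Gaussians, so the mean absolute determinant is `S / 2`. -/
theorem lintegral_lintegral_abs_planeDet_mul_exp {S : ℝ} (hS : 0 < S) :
    ∫⁻ v, (∫⁻ u, ENNReal.ofReal |planeDet u v| * ENNReal.ofReal (Real.exp (-(planeSq u / S)))) *
        ENNReal.ofReal (Real.exp (-(planeSq v / S))) =
      ENNReal.ofReal ((Real.pi * S) ^ 2 * (S / 2)) := by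
  simp only [lintegral_abs_planeDet_mul_exp hS]
  calc ∫⁻ v, ENNReal.ofReal (√Real.pi * S * √S * √(planeSq v)) *
        ENNReal.ofReal (Real.exp (-(planeSq v / S)))
      = ∫⁻ v, ENNReal.ofReal (√Real.pi * S * √S) *
          ENNReal.ofReal (√(planeSq v) * Real.exp (-(planeSq v / S))) := by
        congr with v
        rw [← ENNReal.ofReal_mul (by positivity), ← ENNReal.ofReal_mul (by positivity), mul_assoc]
    _ = _ := by
        rw [lintegral_const_mul _ (by fun_prop), lintegral_sqrt_planeSq_mul_exp hS,
          ← ENNReal.ofReal_mul (by positivity)]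
        congr 1
        have e1 := Real.mul_self_sqrt Real.pi_pos.le
        have e2 := Real.mul_self_sqrt hS.le
        calc √Real.pi * S * √S * (Real.pi * (S * √S * (√Real.pi / 2)))
            = (√Real.pi * √Real.pi) * (√S * √S) * S * S * Real.pi / 2 := by ring
          _ = _ := by rw [e1, e2]; ring

end PlanarIntegrals

/-! ### Evaluation-type maps on pairs of vectors and their Gaussian and ball integrals. -/

section PairedForms

open scoped ENNReal

variable {ι : Type*} [Fintype ι]

/-- The pair of values of the linear form with coefficients `b` on a pair of vectors. -/
def pairForm (b : ι → ℝ) : (Fin 2 → ι → ℝ) →L[ℝ] (Fin 2 → ℝ) :=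
  ContinuousLinearMap.pi fun i =>
    ∑ τ, b τ • ((ContinuousLinearMap.proj τ : (ι → ℝ) →L[ℝ] ℝ) ∘L ContinuousLinearMap.proj i)

theorem pairForm_apply (b : ι → ℝ) (c : Fin 2 → ι → ℝ) (i : Fin 2) :
    pairForm b c i = ∑ τ, c i τ * b τ := by
  simp [pairForm, mul_comm]

/-- The section of `pairForm b` that is orthogonal to its kernel for the weights `w`, where `κ` is
the squared dual norm of `b`. -/
noncomputable def pairSection (w : ι → ℝ) (κ : ℝ) (b : ι → ℝ) : (Fin 2 → ℝ) →L[ℝ] (Fin 2 → ι → ℝ) :=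
  ContinuousLinearMap.pi fun i => ContinuousLinearMap.pi fun τ =>
    (b τ / (w τ * κ)) • ContinuousLinearMap.proj i

theorem pairSection_apply {ι : Type*} (w : ι → ℝ) (κ : ℝ) (b : ι → ℝ) (y : Fin 2 → ℝ) (i : Fin 2) (τ : ι) :
    pairSection w κ b y i τ = b τ / (w τ * κ) * y i := by
  simp [pairSection]

/-- The squared Euclidean norm with weights `w` of a pair of vectors. -/
def pairSq (w : ι → ℝ) (c : Fin 2 → ι → ℝ) : ℝ := ∑ i, ∑ τ, w τ * c i τ ^ 2

@[fun_prop]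
theorem continuous_pairSq (w : ι → ℝ) : Continuous (pairSq w) := by unfold pairSq; fun_prop

@[fun_prop]
theorem measurable_pairSq (w : ι → ℝ) : Measurable (pairSq w) := (continuous_pairSq w).measurable

theorem pairSq_smul (w : ι → ℝ) (r : ℝ) (c : Fin 2 → ι → ℝ) :
    pairSq w (r • c) = r ^ 2 * pairSq w c := by
  simp only [pairSq, Finset.mul_sum, Pi.smul_apply, smul_eq_mul]
  refine Finset.sum_congr rfl fun i _ => Finset.sum_congr rfl fun τ _ => by ring

theorem planeSq_smul (r : ℝ) (y : Fin 2 → ℝ) : planeSq (r • y) = r ^ 2 * planeSq y := by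
  simp [planeSq]; ring

variable {w : ι → ℝ} {b b' : ι → ℝ} {κ S : ℝ}

theorem pairSq_nonneg (hw : ∀ τ, 0 < w τ) (c : Fin 2 → ι → ℝ) : 0 ≤ pairSq w c :=
  Finset.sum_nonneg fun _ _ => Finset.sum_nonneg fun τ _ => mul_nonneg (hw τ).le (sq_nonneg _)

theorem pairForm_pairSection (a : ι → ℝ) (y : Fin 2 → ℝ) :
    pairForm a (pairSection w κ b y) = ((∑ τ, b τ * a τ / w τ) / κ) • y := by
  ext i
  simp only [pairForm_apply, pairSection_apply, Pi.smul_apply, smul_eq_mul, Finset.sum_mul,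
    Finset.sum_div]
  refine Finset.sum_congr rfl fun τ _ => ?_
  rw [← div_div]
  ring

theorem pairForm_pairSection_self (hκ : 0 < κ) (hb : ∑ τ, b τ ^ 2 / w τ = κ) (y : Fin 2 → ℝ) :
    pairForm b (pairSection w κ b y) = y := by
  simp only [pairForm_pairSection, ← sq, hb, div_self hκ.ne', one_smul]

theorem pairForm_pairSection_of_orthogonal (hbb : ∑ τ, b τ * b' τ / w τ = 0) (y : Fin 2 → ℝ) :
    pairForm b' (pairSection w κ b y) = 0 := by
  rw [pairForm_pairSection, hbb]; simp

/-- Pythagoras: the section is orthogonal to the kernel of the form, so changing the value to `y`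
only replaces the normal part of the norm. -/
theorem pairSq_add_pairSection (hw : ∀ τ, 0 < w τ) (hκ : 0 < κ) (hb : ∑ τ, b τ ^ 2 / w τ = κ)
    (c : Fin 2 → ι → ℝ) (y : Fin 2 → ℝ) :
    pairSq w (c + pairSection w κ b (y - pairForm b c)) =
      pairSq w c - planeSq (pairForm b c) / κ + planeSq y / κ := by
  have key : ∀ z : Fin 2 → ℝ, pairSq w (c + pairSection w κ b z) =
      pairSq w c + ∑ i, (2 * pairForm b c i * z i / κ + z i ^ 2 / κ) := by
    intro z
    simp only [pairSq, ← Finset.sum_add_distrib]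
    refine Finset.sum_congr rfl fun i _ => ?_
    have h1 : ∀ τ, w τ * ((c + pairSection w κ b z) i τ) ^ 2 =
        w τ * c i τ ^ 2 + (c i τ * b τ * (2 * z i / κ) + b τ ^ 2 / w τ * (z i ^ 2 / κ ^ 2)) := by
      intro τ
      simp only [Pi.add_apply, pairSection_apply]
      have := (hw τ).ne'
      field_simp
      ring
    simp only [h1, Finset.sum_add_distrib, ← Finset.sum_mul, hb, pairForm_apply]
    field_simp
  rw [key]
  simp only [Fin.sum_univ_two, planeSq, Pi.sub_apply]
  ring

variable (w b κ) in
/-- The squared norm of the component in the kernel of `pairForm b`. -/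
noncomputable def kernelSq (c : Fin 2 → ι → ℝ) : ℝ := pairSq w c - planeSq (pairForm b c) / κ

theorem measurable_kernelSq : Measurable (kernelSq w b κ) := by unfold kernelSq; fun_prop

theorem kernelSq_nonneg (hw : ∀ τ, 0 < w τ) (hκ : 0 < κ) (hb : ∑ τ, b τ ^ 2 / w τ = κ)
    (c : Fin 2 → ι → ℝ) : 0 ≤ kernelSq w b κ c := by
  have h := pairSq_add_pairSection hw hκ hb c 0
  have h0 := pairSq_nonneg hw (c + pairSection w κ b (0 - pairForm b c))
  rw [h] at h0
  simpa [kernelSq, planeSq] using h0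

theorem kernelSq_add_pairSection (hw : ∀ τ, 0 < w τ) (hκ : 0 < κ) (hb : ∑ τ, b τ ^ 2 / w τ = κ)
    (c : Fin 2 → ι → ℝ) (y : Fin 2 → ℝ) :
    kernelSq w b κ (c + pairSection w κ b (y - pairForm b c)) = kernelSq w b κ c := by
  rw [kernelSq, pairSq_add_pairSection hw hκ hb, map_add, pairForm_pairSection_self hκ hb, kernelSq]
  rw [add_sub_cancel]; ring

theorem kernelSq_smul (r : ℝ) (c : Fin 2 → ι → ℝ) :
    kernelSq w b κ (r • c) = r ^ 2 * kernelSq w b κ c := by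
  rw [kernelSq, pairSq_smul, map_smul, planeSq_smul, kernelSq]; ring

theorem lintegral_comp_smul_of_pos {E : Type*} [NormedAddCommGroup E] [NormedSpace ℝ E]
    [MeasurableSpace E] [BorelSpace E] [FiniteDimensional ℝ E] (μ : Measure E) [μ.IsAddHaarMeasure]
    {r : ℝ} (hr : 0 < r) {G : E → ℝ≥0∞} (hG : Measurable G) :
    ENNReal.ofReal (r ^ Module.finrank ℝ E) * ∫⁻ x, G (r • x) ∂μ = ∫⁻ x, G x ∂μ := by
  rw [← lintegral_map hG (measurable_const_smul r), Measure.map_addHaar_smul μ hr.ne',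
    lintegral_smul_measure, smul_eq_mul, ← mul_assoc, ← ENNReal.ofReal_mul (by positivity),
    abs_of_pos (by positivity), mul_inv_cancel₀ (by positivity), ENNReal.ofReal_one, one_mul]

variable (w) in
/-- The total mass of the Gaussian weight. -/
noncomputable def pairGaussianMass : ℝ≥0∞ := ∫⁻ f : Fin 2 → ι → ℝ, ENNReal.ofReal (Real.exp (-pairSq w f))

/-- By Pythagoras the form sends the Gaussian weight to a multiple of the planar Gaussian of scale
`κ`, whose mass is `π κ`. -/
theorem lintegral_pairForm_mul_exp (hw : ∀ τ, 0 < w τ) (hκ : 0 < κ) (hb : ∑ τ, b τ ^ 2 / w τ = κ)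
    {φ : (Fin 2 → ℝ) → ℝ≥0∞} (hφ : Measurable φ) :
    (∫⁻ f, φ (pairForm b f) * ENNReal.ofReal (Real.exp (-pairSq w f))) *
        ENNReal.ofReal (Real.pi * κ) =
      pairGaussianMass w * ∫⁻ y, φ y * ENNReal.ofReal (Real.exp (-(planeSq y / κ))) := by
  obtain ⟨ρ, hρ, hρ1⟩ := exists_density (Fin 2 → ℝ) volume
  have := lintegral_marginal_exp_mul (μ := volume) (ν := volume) (L := pairForm b)
    (pairForm_pairSection_self hκ hb) (measurable_pairSq w) (r := fun y => planeSq y / κ)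
    (by fun_prop) (pairSq_add_pairSection hw hκ hb) hρ hρ1 hφ
  rwa [lintegral_exp_neg_planeSq_div hκ] at this

/-- In effect this integrates a function of degree one over a ball of squared radius `t` in the
kernel, of dimension `2 |ι| - 2`; scaling by `√t` gives the exponent. The transverse density `ρ`
spoils the scaling and is first exchanged for a rescaled copy. -/
theorem setLIntegral_kernelSq_lt (hw : ∀ τ, 0 < w τ) (hκ : 0 < κ) (hb : ∑ τ, b τ ^ 2 / w τ = κ)
    (hbb : ∑ τ, b τ * b' τ / w τ = 0) {ρ : (Fin 2 → ℝ) → ℝ≥0∞} (hρ : Measurable ρ)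
    (hρ1 : ∫⁻ y, ρ y = 1) {φ : (Fin 2 → ℝ) → ℝ≥0∞} (hφ : Measurable φ)
    (hφr : ∀ r : ℝ, 0 < r → ∀ v, φ (r • v) = ENNReal.ofReal r * φ v) {t : ℝ} (ht : 0 < t) :
    ∫⁻ f in {f | kernelSq w b κ f < t}, ρ (pairForm b f) * φ (pairForm b' f) =
      ENNReal.ofReal (t ^ ((2 * (Fintype.card ι : ℝ) - 1) / 2)) *
        ∫⁻ f in {f | kernelSq w b κ f < 1}, ρ (pairForm b f) * φ (pairForm b' f) := by
  have hS : ∀ u : ℝ, MeasurableSet {f | kernelSq w b κ f < u} := fun u =>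
    measurableSet_lt measurable_kernelSq measurable_const
  set r := Real.sqrt t with hr
  have hr0 : 0 < r := Real.sqrt_pos.2 ht
  have hrt : r ^ 2 = t := Real.sq_sqrt ht.le
  set ρr : (Fin 2 → ℝ) → ℝ≥0∞ := fun y => ENNReal.ofReal (r ^ 2)⁻¹ * ρ (r⁻¹ • y) with hρr
  have hρrm : Measurable ρr := by fun_prop
  have hρr1 : ∫⁻ y, ρr y = 1 := by
    rw [← lintegral_comp_smul_of_pos volume hr0 hρrm]
    simp only [hρr, inv_smul_smul₀ hr0.ne', Module.finrank_fin_fun]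
    rw [lintegral_const_mul _ hρ, hρ1, mul_one, ← ENNReal.ofReal_mul (by positivity),
      mul_inv_cancel₀ (by positivity), ENNReal.ofReal_one]
  set G : (Fin 2 → ι → ℝ) → ℝ≥0∞ := fun f =>
    φ (pairForm b' f) * {f | kernelSq w b κ f < t}.indicator 1 f with hG
  have hGm : Measurable G := by
    refine Measurable.mul (by fun_prop) (measurable_one.indicator (hS t))
  -- `G` is constant transversally to the kernel, so its integral against `ρ` depends only on the
  -- mass of `ρ`.
  have hinv : ∀ f, G (f + pairSection w κ b (0 - pairForm b f)) = G f := by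
    intro f
    simp only [hG, indicator, mem_ofPred_eq, kernelSq_add_pairSection hw hκ hb, map_add,
      pairForm_pairSection_of_orthogonal hbb, add_zero, Pi.one_apply]
  have hfib := lintegral_fiber_congr (μ := volume) (ν := volume)
    (pairForm_pairSection_self hκ hb) (pairForm_pairSection_self hκ hb) hρ hρ1 hρrm hρr1 hGm 0
  simp only [hinv] at hfib
  calc ∫⁻ f in {f | kernelSq w b κ f < t}, ρ (pairForm b f) * φ (pairForm b' f)
      = ∫⁻ f, ρ (pairForm b f) * G f := by
        rw [← lintegral_indicator (hS t)]
        congr with f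
        by_cases h : kernelSq w b κ f < t <;> simp [indicator, hG, h]
    _ = ∫⁻ f, ρr (pairForm b f) * G f := hfib
    _ = ENNReal.ofReal (r ^ (Module.finrank ℝ (Fin 2 → ι → ℝ))) *
          ∫⁻ f, ENNReal.ofReal ((r ^ 2)⁻¹ * r) * {f | kernelSq w b κ f < 1}.indicator
            (fun f => ρ (pairForm b f) * φ (pairForm b' f)) f := by
        rw [← lintegral_comp_smul_of_pos volume hr0 (by fun_prop)]
        congr with f
        have hlt : kernelSq w b κ (r • f) < t ↔ kernelSq w b κ f < 1 := by
          rw [kernelSq_smul, hrt, mul_lt_iff_lt_one_right ht]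
        simp only [hρr, hG, map_smul, inv_smul_smul₀ hr0.ne', hφr r hr0, indicator,
          mem_ofPred_eq, hlt]
        rw [ENNReal.ofReal_mul (by positivity)]
        split_ifs
        · simp only [Pi.one_apply]; ring
        · simp
    _ = _ := by
        rw [lintegral_const_mul _ (Measurable.indicator (by fun_prop) (hS 1)),
          lintegral_indicator (hS 1), ← mul_assoc, ← ENNReal.ofReal_mul (by positivity)]
        congr 2
        -- The powers of `r = √t` are `2 |ι|` from the volume, `-2` from the rescaled density and
        -- `1` from `φ`.
        have hfr : Module.finrank ℝ (Fin 2 → ι → ℝ) = 2 * Fintype.card ι := by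
          rw [Module.finrank_pi_fintype]; simp
        rw [hfr, hr, Real.sqrt_eq_rpow, ← Real.rpow_natCast, ← Real.rpow_natCast,
          ← Real.rpow_mul ht.le, ← Real.rpow_mul ht.le, ← Real.rpow_neg ht.le, ← Real.rpow_add ht,
          ← Real.rpow_add ht]
        congr 1
        push_cast
        ring

/-- Fibre integrals over balls, in terms of planar Gaussian integrals. -/
theorem setLIntegral_kernelSq_lt_eq [Nonempty ι] (hw : ∀ τ, 0 < w τ) (hκ : 0 < κ)
    (hb : ∑ τ, b τ ^ 2 / w τ = κ)
    (hbb : ∑ τ, b τ * b' τ / w τ = 0) (hS : 0 < S) (hb' : ∑ τ, b' τ ^ 2 / w τ = S)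
    {ρ : (Fin 2 → ℝ) → ℝ≥0∞} (hρ : Measurable ρ)
    (hρ1 : ∫⁻ y, ρ y = 1) {φ : (Fin 2 → ℝ) → ℝ≥0∞} (hφ : Measurable φ)
    (hφr : ∀ r : ℝ, 0 < r → ∀ v, φ (r • v) = ENNReal.ofReal r * φ v) {t : ℝ} (ht : 0 < t) :
    ∫⁻ f in {f | kernelSq w b κ f < t}, ρ (pairForm b f) * φ (pairForm b' f) =
      ENNReal.ofReal (t ^ ((2 * (Fintype.card ι : ℝ) - 1) / 2)) *
        ((pairGaussianMass w * ∫⁻ y, φ y * ENNReal.ofReal (Real.exp (-(planeSq y / S)))) /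
          ENNReal.ofReal (Real.Gamma (Fintype.card ι + 1 / 2) * (Real.pi * κ) * (Real.pi * S))) := by
  have hcard : (1 : ℝ) ≤ Fintype.card ι := by exact_mod_cast Fintype.card_pos
  rw [setLIntegral_kernelSq_lt hw hκ hb hbb hρ hρ1 hφ hφr ht]
  congr 1
  set T := ∫⁻ f in {f | kernelSq w b κ f < 1}, ρ (pairForm b f) * φ (pairForm b' f) with hT
  have h1 := lintegral_mul_exp_neg_of_sublevel (μ := volume)
    (Φ := fun f => ρ (pairForm b f) * φ (pairForm b' f)) (by fun_prop)
    (measurable_kernelSq (w := w) (b := b) (κ := κ)) (kernelSq_nonneg hw hκ hb)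
    (p := (2 * (Fintype.card ι : ℝ) - 1) / 2) (by linarith) (A := T)
    (fun t ht => setLIntegral_kernelSq_lt hw hκ hb hbb hρ hρ1 hφ hφr ht)
  have hp : (2 * (Fintype.card ι : ℝ) - 1) / 2 + 1 = Fintype.card ι + 1 / 2 := by ring
  rw [hp] at h1
  -- A normalised planar Gaussian as transverse density completes the Gaussian on the kernel to the
  -- full one, whose image under `pairForm b'` is known.
  set σ : (Fin 2 → ℝ) → ℝ≥0∞ := fun y =>
    ENNReal.ofReal (Real.pi * κ)⁻¹ * ENNReal.ofReal (Real.exp (-(planeSq y / κ))) with hσ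
  have hσ1 : ∫⁻ y, σ y = 1 := by
    rw [lintegral_const_mul _ (by fun_prop), lintegral_exp_neg_planeSq_div hκ,
      ← ENNReal.ofReal_mul (by positivity), inv_mul_cancel₀ (by positivity), ENNReal.ofReal_one]
  have hkm : Measurable (kernelSq w b κ) := measurable_kernelSq
  have hfib := lintegral_fiber_congr (μ := volume) (ν := volume)
    (pairForm_pairSection_self hκ hb) (pairForm_pairSection_self hκ hb) hρ hρ1
    (by fun_prop : Measurable σ) hσ1 (G := fun f => φ (pairForm b' f) *
      ENNReal.ofReal (Real.exp (-kernelSq w b κ f))) (by fun_prop) 0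
  simp only [kernelSq_add_pairSection hw hκ hb, map_add,
    pairForm_pairSection_of_orthogonal hbb, add_zero] at hfib
  simp only [mul_assoc] at h1
  rw [hfib] at h1
  have h2 : ∫⁻ f, σ (pairForm b f) * (φ (pairForm b' f) *
      ENNReal.ofReal (Real.exp (-kernelSq w b κ f))) = ENNReal.ofReal (Real.pi * κ)⁻¹ *
        ∫⁻ f, φ (pairForm b' f) * ENNReal.ofReal (Real.exp (-pairSq w f)) := by
    rw [← lintegral_const_mul _ (by fun_prop)]
    congr with f
    have : ENNReal.ofReal (Real.exp (-pairSq w f)) =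
        ENNReal.ofReal (Real.exp (-(planeSq (pairForm b f) / κ))) *
          ENNReal.ofReal (Real.exp (-kernelSq w b κ f)) := by
      rw [← ENNReal.ofReal_mul (Real.exp_pos _).le, ← Real.exp_add, kernelSq]
      congr 2; ring
    rw [this]
    simp only [hσ]
    ring
  rw [h2] at h1
  have h3 := lintegral_pairForm_mul_exp hw hS hb' hφ
  have hΓ : 0 < Real.Gamma (Fintype.card ι + 1 / 2) := Real.Gamma_pos_of_pos (by linarith)
  rw [← h3, ENNReal.eq_div_iff (by simp; positivity) ENNReal.ofReal_ne_top,
    mul_assoc (Real.Gamma _), ENNReal.ofReal_mul hΓ.le, mul_comm (ENNReal.ofReal (Real.Gamma _)),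
    mul_assoc, ← h1, ENNReal.ofReal_mul (by positivity : 0 ≤ Real.pi * κ)]
  have h4 : ENNReal.ofReal (Real.pi * κ) * ENNReal.ofReal (Real.pi * κ)⁻¹ = 1 := by
    rw [← ENNReal.ofReal_mul (by positivity), mul_inv_cancel₀ (by positivity), ENNReal.ofReal_one]
  calc _ = (ENNReal.ofReal (Real.pi * κ) * ENNReal.ofReal (Real.pi * κ)⁻¹) *
        ((∫⁻ f, φ (pairForm b' f) * ENNReal.ofReal (Real.exp (-pairSq w f))) *
          ENNReal.ofReal (Real.pi * S)) := by ring
    _ = _ := by rw [h4, one_mul]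

theorem volume_pairSq_lt (w : ι → ℝ) {t : ℝ} (ht : 0 < t) :
    volume {f : Fin 2 → ι → ℝ | pairSq w f < t} =
      ENNReal.ofReal (t ^ (Fintype.card ι : ℝ)) * volume {f : Fin 2 → ι → ℝ | pairSq w f < 1} := by
  have hr0 : 0 < Real.sqrt t := Real.sqrt_pos.2 ht
  have hm : ∀ u : ℝ, MeasurableSet {f : Fin 2 → ι → ℝ | pairSq w f < u} := fun u =>
    measurableSet_lt (by fun_prop) measurable_const
  rw [← lintegral_indicator_one (hm t), ← lintegral_indicator_one (hm 1),
    ← lintegral_comp_smul_of_pos volume hr0 (measurable_one.indicator (hm t))]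
  congr 1
  · have hfr : Module.finrank ℝ (Fin 2 → ι → ℝ) = 2 * Fintype.card ι := by
      rw [Module.finrank_pi_fintype]; simp
    rw [hfr, pow_mul, Real.sq_sqrt ht.le, Real.rpow_natCast]
  · congr with f
    have hlt : pairSq w (Real.sqrt t • f) < t ↔ pairSq w f < 1 := by
      rw [pairSq_smul, Real.sq_sqrt ht.le, mul_lt_iff_lt_one_right ht]
    simp only [indicator, mem_ofPred_eq, hlt]
    rfl

/-- The layer-cake lemma with `Φ = 1`. It brings in the volume of the unit ball, by which the mean
is normalised. -/
theorem pairGaussianMass_eq (hw : ∀ τ, 0 < w τ) :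
    pairGaussianMass w = ENNReal.ofReal (Real.Gamma (Fintype.card ι + 1)) *
      volume {f : Fin 2 → ι → ℝ | pairSq w f < 1} := by
  have h := lintegral_mul_exp_neg_of_sublevel (μ := (volume : Measure (Fin 2 → ι → ℝ)))
    (Φ := 1) measurable_one (measurable_pairSq w) (pairSq_nonneg hw)
    (p := (Fintype.card ι : ℝ)) (by have : (0 : ℝ) ≤ Fintype.card ι := Nat.cast_nonneg _; linarith)
    (A := volume {f : Fin 2 → ι → ℝ | pairSq w f < 1})
    (fun t ht => by rw [← volume_pairSq_lt w ht]; simp)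
  simpa [pairGaussianMass] using h

end PairedForms

/-! ### The Kac–Rice density at a fixed pair of parameters. -/

section Incidence

open scoped ENNReal

variable {ι : Type*} [Fintype ι] {w : ι → ℝ} {κ S : ℝ}

theorem abs_planeDet_comm (u v : Fin 2 → ℝ) : |planeDet u v| = |planeDet v u| := by
  rw [← abs_neg]; congr 1; unfold planeDet; ring

theorem planeDet_smul_right (r : ℝ) (u v : Fin 2 → ℝ) : planeDet u (r • v) = r * planeDet u v := by
  simp [planeDet]; ring

@[fun_prop]
theorem measurable_planeDet {X : Type*} [MeasurableSpace X] {u v : X → Fin 2 → ℝ}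
    (hu : Measurable u) (hv : Measurable v) : Measurable fun x => planeDet (u x) (v x) := by
  unfold planeDet; fun_prop

variable (w) in
/-- The indicator of the unit ball. -/
noncomputable def pairBall : (Fin 2 → ι → ℝ) → ℝ≥0∞ := {f | pairSq w f < 1}.indicator 1

theorem measurableSet_pairSq_lt (t : ℝ) : MeasurableSet {f : Fin 2 → ι → ℝ | pairSq w f < t} :=
  measurableSet_lt (by fun_prop) measurable_const

@[fun_prop]
theorem measurable_pairBall : Measurable (pairBall w) :=
  measurable_one.indicator (measurableSet_pairSq_lt 1)

theorem pairBall_add_pairSection {b : ι → ℝ} (hw : ∀ τ, 0 < w τ) (hκ : 0 < κ)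
    (hb : ∑ τ, b τ ^ 2 / w τ = κ) (c : Fin 2 → ι → ℝ) (y : Fin 2 → ℝ) :
    pairBall w (c + pairSection w κ b (y - pairForm b c)) =
      {f | kernelSq w b κ f < 1 - planeSq y / κ}.indicator 1 c := by
  have : pairSq w (c + pairSection w κ b (y - pairForm b c)) < 1 ↔
      kernelSq w b κ c < 1 - planeSq y / κ := by
    rw [pairSq_add_pairSection hw hκ hb, kernelSq, lt_sub_iff_add_lt]
  simp only [pairBall, indicator, mem_ofPred_eq, this, Pi.one_apply]

/-- The integral over the unit ball of a fibre. -/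
theorem lintegral_mul_pairBall_add_pairSection [Nonempty ι] {b b' : ι → ℝ} (hw : ∀ τ, 0 < w τ)
    (hκ : 0 < κ)
    (hb : ∑ τ, b τ ^ 2 / w τ = κ)
    (hbb : ∑ τ, b τ * b' τ / w τ = 0) (hS : 0 < S) (hb' : ∑ τ, b' τ ^ 2 / w τ = S)
    {ρ : (Fin 2 → ℝ) → ℝ≥0∞} (hρ : Measurable ρ)
    (hρ1 : ∫⁻ y, ρ y = 1) {φ : (Fin 2 → ℝ) → ℝ≥0∞} (hφ : Measurable φ)
    (hφr : ∀ r : ℝ, 0 < r → ∀ v, φ (r • v) = ENNReal.ofReal r * φ v) (y : Fin 2 → ℝ) :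
    ∫⁻ f, ρ (pairForm b f) * (φ (pairForm b' f) *
        pairBall w (f + pairSection w κ b (y - pairForm b f))) =
      {y | planeSq y < κ}.indicator (fun y => ENNReal.ofReal
        ((1 - planeSq y / κ) ^ ((2 * (Fintype.card ι : ℝ) - 1) / 2))) y *
        ((pairGaussianMass w * ∫⁻ y, φ y * ENNReal.ofReal (Real.exp (-(planeSq y / S)))) /
          ENNReal.ofReal (Real.Gamma (Fintype.card ι + 1 / 2) * (Real.pi * κ) * (Real.pi * S))) := by
  have hm : MeasurableSet {f | kernelSq w b κ f < 1 - planeSq y / κ} :=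
    measurableSet_lt measurable_kernelSq measurable_const
  have h1 : ∀ f, ρ (pairForm b f) * (φ (pairForm b' f) *
      pairBall w (f + pairSection w κ b (y - pairForm b f))) =
      {f | kernelSq w b κ f < 1 - planeSq y / κ}.indicator
        (fun f => ρ (pairForm b f) * φ (pairForm b' f)) f := by
    intro f
    rw [pairBall_add_pairSection hw hκ hb]
    by_cases h : kernelSq w b κ f < 1 - planeSq y / κ <;> simp [indicator, h]
  simp only [h1]
  rw [lintegral_indicator hm]
  by_cases hy : planeSq y < κ
  · have ht : 0 < 1 - planeSq y / κ := sub_pos.2 ((div_lt_one hκ).2 hy)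
    rw [setLIntegral_kernelSq_lt_eq hw hκ hb hbb hS hb' hρ hρ1 hφ hφr ht]
    simp [indicator, hy]
  · have hempty : {f | kernelSq w b κ f < 1 - planeSq y / κ} = ∅ := by
      ext f
      have h0 := kernelSq_nonneg hw hκ hb f
      have : 1 ≤ planeSq y / κ := (one_le_div hκ).2 (not_lt.1 hy)
      simp only [mem_ofPred_eq, mem_empty_iff_false, iff_false, not_lt]
      linarith
    rw [hempty]
    simp [indicator, hy]

/-- The integral of the Kac–Rice density over pairs of vectors in the unit ball. -/
theorem lintegral_lintegral_incidence [Nonempty ι] {a a' b b' : ι → ℝ} (hw : ∀ τ, 0 < w τ)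
    (hκ : 0 < κ) (hS : 0 < S)
    (ha : ∑ τ, a τ ^ 2 / w τ = κ) (haa : ∑ τ, a τ * a' τ / w τ = 0)
    (ha' : ∑ τ, a' τ ^ 2 / w τ = S)
    (hb : ∑ τ, b τ ^ 2 / w τ = κ) (hbb : ∑ τ, b τ * b' τ / w τ = 0)
    (hb' : ∑ τ, b' τ ^ 2 / w τ = S)
    {ρ : (Fin 2 → ℝ) → ℝ≥0∞} (hρ : Measurable ρ) (hρ1 : ∫⁻ y, ρ y = 1)
    {c : (Fin 2 → ℝ) →L[ℝ] (Fin 2 → ι → ℝ)} (hc : ∀ y, pairForm b (c y) = y)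
    (hc' : ∀ y, pairForm b' (c y) = 0) :
    ∫⁻ f, ∫⁻ g, ρ (pairForm a f - pairForm b g) *
        (ENNReal.ofReal |planeDet (pairForm a' f) (pairForm b' g)| *
          (pairBall w f * pairBall w (g + c (pairForm a f - pairForm b g)))) =
      ENNReal.ofReal (Real.pi * κ / (2 * Fintype.card ι)) *
        (pairGaussianMass w / ENNReal.ofReal
          (Real.Gamma (Fintype.card ι + 1 / 2) * (Real.pi * κ) * (Real.pi * S))) ^ 2 *
        ENNReal.ofReal ((Real.pi * S) ^ 2 * (S / 2)) := by
  set C := ENNReal.ofReal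
    (Real.Gamma (Fintype.card ι + 1 / 2) * (Real.pi * κ) * (Real.pi * S)) with hC
  -- Integrating out `g` leaves this function of the derivative of `f`. It is again homogeneous of
  -- degree one, so the same fibre lemma applies to `f`.
  set D : (Fin 2 → ℝ) → ℝ≥0∞ := fun u =>
    ∫⁻ v, ENNReal.ofReal |planeDet v u| * ENNReal.ofReal (Real.exp (-(planeSq v / S))) with hD
  have hDeq : D = fun u => ENNReal.ofReal (√Real.pi * S * √S * √(planeSq u)) := by
    ext u; exact lintegral_abs_planeDet_mul_exp hS u
  have hDm : Measurable D := by rw [hDeq]; fun_prop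
  have hDr : ∀ r : ℝ, 0 < r → ∀ v, D (r • v) = ENNReal.ofReal r * D v := by
    intro r hr v
    simp only [hDeq, planeSq_smul]
    rw [← ENNReal.ofReal_mul hr.le, Real.sqrt_mul (sq_nonneg r), Real.sqrt_sq hr.le]
    congr 1; ring
  set R : (Fin 2 → ℝ) → ℝ≥0∞ := {y | planeSq y < κ}.indicator (fun y => ENNReal.ofReal
        ((1 - planeSq y / κ) ^ ((2 * (Fintype.card ι : ℝ) - 1) / 2))) with hR
  have hRm : Measurable R := by
    refine Measurable.indicator (by fun_prop) (measurableSet_lt (by fun_prop) measurable_const)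
  have inner : ∀ f, ∫⁻ g, ρ (pairForm a f - pairForm b g) *
        (ENNReal.ofReal |planeDet (pairForm a' f) (pairForm b' g)| *
          (pairBall w f * pairBall w (g + c (pairForm a f - pairForm b g)))) =
      pairBall w f * (R (pairForm a f) * ((pairGaussianMass w * D (pairForm a' f)) / C)) := by
    intro f
    -- The section `c` is exchanged for the orthogonal one. Both have image in the kernel of
    -- `pairForm b'`, so the determinant is unaffected.
    have hfib := lintegral_fiber_congr (μ := volume) (ν := volume) (L := pairForm b) hc
      (pairForm_pairSection_self hκ hb) (ρ := fun y => ρ (pairForm a f - y)) (by fun_prop)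
      (by rw [lintegral_sub_left_eq_self ρ, hρ1]) hρ hρ1
      (G := fun g => ENNReal.ofReal |planeDet (pairForm a' f) (pairForm b' g)| * pairBall w g)
      (by fun_prop) (pairForm a f)
    simp only [map_add, hc', pairForm_pairSection_of_orthogonal hbb, add_zero] at hfib
    rw [lintegral_mul_pairBall_add_pairSection hw hκ hb hbb hS hb' hρ hρ1
      (φ := fun v => ENNReal.ofReal |planeDet (pairForm a' f) v|) (by fun_prop)
      (fun r hr v => by
        rw [planeDet_smul_right, abs_mul, abs_of_pos hr, ENNReal.ofReal_mul hr.le])] at hfib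
    simp only [abs_planeDet_comm (pairForm a' f)] at hfib ⊢
    rw [← hfib, ← lintegral_const_mul _ (by fun_prop)]
    congr with g
    ring
  simp only [inner]
  rw [lintegral_eq_lintegral_lintegral_fiber (μ := volume) (ν := volume) (L := pairForm a)
    (pairForm_pairSection_self hκ ha) hρ hρ1 (by fun_prop)]
  -- The fibres of `f` and of `g` over the common value `y` each give the exponent `(2 |ι| - 1) /
  -- 2`; together they give the integer `2 |ι| - 1`.
  have houter : ∀ y, ∫⁻ f, ρ (pairForm a f) *
      (pairBall w (f + pairSection w κ a (y - pairForm a f)) *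
        (R (pairForm a (f + pairSection w κ a (y - pairForm a f))) *
          (pairGaussianMass w * D (pairForm a' (f + pairSection w κ a (y - pairForm a f))) / C))) =
      (pairGaussianMass w / C) ^ 2 * ENNReal.ofReal ((Real.pi * S) ^ 2 * (S / 2)) *
        {y | planeSq y < κ}.indicator
          (fun y => ENNReal.ofReal ((1 - planeSq y / κ) ^ (2 * Fintype.card ι - 1))) y := by
    intro y
    have h := lintegral_mul_pairBall_add_pairSection hw hκ ha haa hS ha' hρ hρ1 hDm hDr y
    rw [lintegral_lintegral_abs_planeDet_mul_exp hS] at h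
    calc _ = ∫⁻ f, R y * (pairGaussianMass w / C) * (ρ (pairForm a f) * (D (pairForm a' f) *
            pairBall w (f + pairSection w κ a (y - pairForm a f)))) := by
          congr with f
          rw [map_add, pairForm_pairSection_self hκ ha, add_sub_cancel, map_add,
            pairForm_pairSection_of_orthogonal haa, add_zero]
          simp only [div_eq_mul_inv]
          ring
      _ = R y * (pairGaussianMass w / C) * (R y * ((pairGaussianMass w *
            ENNReal.ofReal ((Real.pi * S) ^ 2 * (S / 2))) / C)) := by
          rw [lintegral_const_mul _ (by fun_prop), h]
      _ = (pairGaussianMass w / C) ^ 2 * ENNReal.ofReal ((Real.pi * S) ^ 2 * (S / 2)) *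
            (R y * R y) := by
          simp only [div_eq_mul_inv]; ring
      _ = _ := by
          congr 1
          by_cases hy : planeSq y < κ
          · have ht : 0 < 1 - planeSq y / κ := sub_pos.2 ((div_lt_one hκ).2 hy)
            simp only [hR, indicator, mem_ofPred_eq, hy, if_true]
            rw [← ENNReal.ofReal_mul (by positivity), ← Real.rpow_add ht, add_halves,
              ← Real.rpow_natCast, Nat.cast_sub (by have : 0 < Fintype.card ι := Fintype.card_pos
                                                    omega)]
            push_cast
            rfl
          · simp [hR, indicator, hy]
  simp only [houter]
  have hset : MeasurableSet {y : Fin 2 → ℝ | planeSq y < κ} :=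
    measurableSet_lt (by fun_prop) measurable_const
  rw [lintegral_const_mul _ (Measurable.indicator (by fun_prop) hset), lintegral_indicator hset,
    lintegral_one_sub_planeSq_div_pow hκ, Nat.cast_sub (by
      have : 0 < Fintype.card ι := Fintype.card_pos
      omega)]
  push_cast
  rw [sub_add_cancel]
  ring

end Incidence

/-! ### Orthogonality relations of the trigonometric basis. -/

section TrigonometricBasis

open scoped ENNReal

/-- The trigonometric basis functions. -/
noncomputable def trigVec (N : ℕ) (φ : ℝ) : Fin (N + 1) ⊕ Fin N → ℝ :=
  Sum.elim (fun j => Real.cos ((j : ℕ) * φ)) (fun j => Real.sin (((j : ℕ) + 1) * φ))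

/-- The derivatives of the trigonometric basis functions. -/
noncomputable def trigDeriv (N : ℕ) (φ : ℝ) : Fin (N + 1) ⊕ Fin N → ℝ :=
  Sum.elim (fun j => -((j : ℕ) * Real.sin ((j : ℕ) * φ)))
    (fun j => ((j : ℕ) + 1) * Real.cos (((j : ℕ) + 1) * φ))

/-- The squared norms of the trigonometric basis functions, divided by `π`. -/
noncomputable def trigWeight (N : ℕ) : Fin (N + 1) ⊕ Fin N → ℝ :=
  Sum.elim (fun j => if j = 0 then 2 else 1) (fun _ => 1)

theorem trigWeight_pos (N : ℕ) (τ) : 0 < trigWeight N τ := by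
  rcases τ with j | j
  · simp only [trigWeight, Sum.elim_inl]; split_ifs <;> norm_num
  · simp [trigWeight]

theorem hasDerivAt_trigVec (N : ℕ) (φ : ℝ) (τ) :
    HasDerivAt (fun φ => trigVec N φ τ) (trigDeriv N φ τ) φ := by
  rcases τ with j | j
  · simp only [trigVec, trigDeriv, Sum.elim_inl]
    convert (((hasDerivAt_id' φ).const_mul ((j : ℕ) : ℝ)).cos) using 1
    ring
  · simp only [trigVec, trigDeriv, Sum.elim_inr]
    convert (((hasDerivAt_id' φ).const_mul (((j : ℕ) : ℝ) + 1)).sin) using 1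
    ring

@[fun_prop]
theorem continuous_trigVec (N : ℕ) : Continuous (trigVec N) := by
  refine continuous_pi fun τ => ?_
  rcases τ with j | j <;> simp only [trigVec, Sum.elim_inl, Sum.elim_inr] <;> fun_prop

@[fun_prop]
theorem continuous_trigDeriv (N : ℕ) : Continuous (trigDeriv N) := by
  refine continuous_pi fun τ => ?_
  rcases τ with j | j <;> simp only [trigDeriv, Sum.elim_inl, Sum.elim_inr] <;> fun_prop

/-- Each frequency contributes `cos² + sin² = 1` and the constant contributes `1/2`. Together with
the next two identities this removes the parameter `φ` from the Kac–Rice density. -/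
theorem sum_trigVec_sq (N : ℕ) (φ : ℝ) :
    ∑ τ, trigVec N φ τ ^ 2 / trigWeight N τ = N + 1 / 2 := by
  rw [Fintype.sum_sum_type, Fin.sum_univ_succ, add_assoc, ← Finset.sum_add_distrib]
  have : ∀ j : Fin N, trigVec N φ (Sum.inl j.succ) ^ 2 / trigWeight N (Sum.inl j.succ) +
      trigVec N φ (Sum.inr j) ^ 2 / trigWeight N (Sum.inr j) = 1 := by
    intro j
    simp [trigVec, trigWeight, Fin.succ_ne_zero]
  simp only [this]
  simp [trigVec, trigWeight]
  ring

theorem sum_trigVec_mul_trigDeriv (N : ℕ) (φ : ℝ) :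
    ∑ τ, trigVec N φ τ * trigDeriv N φ τ / trigWeight N τ = 0 := by
  rw [Fintype.sum_sum_type, Fin.sum_univ_succ, add_assoc, ← Finset.sum_add_distrib]
  have : ∀ j : Fin N, trigVec N φ (Sum.inl j.succ) * trigDeriv N φ (Sum.inl j.succ) /
      trigWeight N (Sum.inl j.succ) +
      trigVec N φ (Sum.inr j) * trigDeriv N φ (Sum.inr j) / trigWeight N (Sum.inr j) = 0 := by
    intro j
    simp [trigVec, trigDeriv, trigWeight, Fin.succ_ne_zero]
    ring
  simp only [this]
  simp [trigVec, trigDeriv, trigWeight]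

theorem sum_trigDeriv_sq (N : ℕ) (φ : ℝ) :
    ∑ τ, trigDeriv N φ τ ^ 2 / trigWeight N τ = ∑ j ∈ Finset.Icc 1 N, (j : ℝ) ^ 2 := by
  rw [Fintype.sum_sum_type, Fin.sum_univ_succ, add_assoc, ← Finset.sum_add_distrib]
  have : ∀ j : Fin N, trigDeriv N φ (Sum.inl j.succ) ^ 2 / trigWeight N (Sum.inl j.succ) +
      trigDeriv N φ (Sum.inr j) ^ 2 / trigWeight N (Sum.inr j) = ((j : ℕ) + 1 : ℝ) ^ 2 := by
    intro j
    simp only [trigDeriv, trigWeight, Fin.succ_ne_zero, Sum.elim_inl, Sum.elim_inr, Fin.val_succ,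
      if_false, div_one]
    push_cast
    linear_combination ((j : ℕ) + 1 : ℝ) ^ 2 * Real.sin_sq_add_cos_sq (((j : ℕ) + 1 : ℝ) * φ)
  simp only [this]
  have h := Finset.sum_Ico_add' (fun j : ℕ => (j : ℝ) ^ 2) 0 N 1
  simp only [Nat.cast_add, Nat.cast_one] at h
  have hI : Finset.Ico (0 + 1) (N + 1) = Finset.Icc 1 N := by
    ext j; simp only [Finset.mem_Ico, Finset.mem_Icc]; omega
  rw [Fin.sum_univ_eq_sum_range (fun j => ((j : ℝ) + 1) ^ 2) N, Finset.range_eq_Ico, h, hI]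
  simp [trigDeriv]

theorem integral_cos_int_mul (k : ℤ) :
    ∫ φ in (0 : ℝ)..(2 * Real.pi), Real.cos (k * φ) = if k = 0 then 2 * Real.pi else 0 := by
  split_ifs with hk
  · simp [hk]
  · have hk' : (k : ℝ) ≠ 0 := by exact_mod_cast hk
    rw [intervalIntegral.integral_comp_mul_left (fun x => Real.cos x) hk', integral_cos]
    have : Real.sin (k * (2 * Real.pi)) = 0 := by
      have := Real.sin_int_mul_pi (2 * k)
      rw [← this]; congr 1; push_cast; ring
    simp [this]

theorem integral_sin_int_mul (k : ℤ) :
    ∫ φ in (0 : ℝ)..(2 * Real.pi), Real.sin (k * φ) = 0 := by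
  by_cases hk : k = 0
  · simp [hk]
  · have hk' : (k : ℝ) ≠ 0 := by exact_mod_cast hk
    rw [intervalIntegral.integral_comp_mul_left (fun x => Real.sin x) hk', integral_sin]
    have : Real.cos (k * (2 * Real.pi)) = 1 := Real.cos_int_mul_two_pi k
    simp [this]

theorem integral_cos_mul_cos_int (j k : ℤ) :
    ∫ φ in (0 : ℝ)..(2 * Real.pi), Real.cos (j * φ) * Real.cos (k * φ) =
      ((if j - k = 0 then 2 * Real.pi else 0) + (if j + k = 0 then 2 * Real.pi else 0)) / 2 := by
  rw [← integral_cos_int_mul, ← integral_cos_int_mul, ← intervalIntegral.integral_add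
    (Continuous.intervalIntegrable (by fun_prop) _ _)
    (Continuous.intervalIntegrable (by fun_prop) _ _), ← intervalIntegral.integral_div]
  congr with φ
  push_cast
  rw [sub_mul, add_mul, Real.cos_sub, Real.cos_add]
  ring

theorem integral_sin_mul_sin_int (j k : ℤ) :
    ∫ φ in (0 : ℝ)..(2 * Real.pi), Real.sin (j * φ) * Real.sin (k * φ) =
      ((if j - k = 0 then 2 * Real.pi else 0) - (if j + k = 0 then 2 * Real.pi else 0)) / 2 := by
  rw [← integral_cos_int_mul, ← integral_cos_int_mul, ← intervalIntegral.integral_sub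
    (Continuous.intervalIntegrable (by fun_prop) _ _)
    (Continuous.intervalIntegrable (by fun_prop) _ _), ← intervalIntegral.integral_div]
  congr with φ
  push_cast
  rw [sub_mul, add_mul, Real.cos_sub, Real.cos_add]
  ring

theorem integral_cos_mul_sin_int (j k : ℤ) :
    ∫ φ in (0 : ℝ)..(2 * Real.pi), Real.cos (j * φ) * Real.sin (k * φ) = 0 := by
  have h : ∀ φ : ℝ, Real.cos (j * φ) * Real.sin (k * φ) =
      (Real.sin ((j + k : ℤ) * φ) - Real.sin ((j - k : ℤ) * φ)) / 2 := by
    intro φ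
    push_cast
    rw [sub_mul, add_mul, Real.sin_sub, Real.sin_add]
    ring
  simp only [h]
  rw [intervalIntegral.integral_div, intervalIntegral.integral_sub
    (Continuous.intervalIntegrable (by fun_prop) _ _)
    (Continuous.intervalIntegrable (by fun_prop) _ _), integral_sin_int_mul, integral_sin_int_mul]
  simp

theorem integral_trigVec_mul_trigVec (N : ℕ) (τ σ) :
    ∫ φ in (0 : ℝ)..(2 * Real.pi), trigVec N φ τ * trigVec N φ σ =
      if τ = σ then Real.pi * trigWeight N τ else 0 := by
  rcases τ with j | j <;> rcases σ with k | k <;>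
    simp only [trigVec, trigWeight, Sum.elim_inl, Sum.elim_inr, Sum.inl.injEq, Sum.inr.injEq,
      reduceCtorEq, if_false]
  · have := integral_cos_mul_cos_int (j : ℕ) (k : ℕ)
    push_cast at this
    rw [this]
    have e1 : ((j : ℕ) : ℤ) - (k : ℕ) = 0 ↔ j = k := by rw [Fin.ext_iff]; omega
    have e2 : ((j : ℕ) : ℤ) + (k : ℕ) = 0 ↔ j = k ∧ j = 0 := by
      rw [Fin.ext_iff, Fin.ext_iff, Fin.val_zero]; omega
    simp only [e1, e2]
    by_cases h : j = k
    · by_cases h0 : j = 0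
      · subst h; simp [h0]; ring
      · subst h; simp [h0]
    · simp [h]
  · have := integral_cos_mul_sin_int (j : ℕ) ((k : ℕ) + 1)
    push_cast at this
    exact this
  · have := integral_cos_mul_sin_int (k : ℕ) ((j : ℕ) + 1)
    push_cast at this
    simpa only [mul_comm] using this
  · have := integral_sin_mul_sin_int ((j : ℕ) + 1) ((k : ℕ) + 1)
    push_cast at this
    rw [this]
    have e1 : ((j : ℕ) : ℤ) + 1 - ((k : ℕ) + 1) = 0 ↔ j = k := by rw [Fin.ext_iff]; omega
    have e2 : ¬ ((j : ℕ) : ℤ) + 1 + ((k : ℕ) + 1) = 0 := by omega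
    simp only [e1, e2]
    by_cases h : j = k <;> simp [h]

namespace TrigCurve

variable {N : ℕ}

theorem eval_eq_pairForm (c : TrigCurve N) (φ : ℝ) : c.eval φ = pairForm (trigVec N φ) c := by
  ext i
  rw [pairForm_apply, Fintype.sum_sum_type]
  rfl

theorem l2Norm_eq_sqrt_pairSq (c : TrigCurve N) : c.l2Norm = Real.sqrt (pairSq (trigWeight N) c) := by
  have key : ∀ i, ∫ φ in (0 : ℝ)..(2 * Real.pi), (c.eval φ i) ^ 2 =
      Real.pi * ∑ τ, trigWeight N τ * c i τ ^ 2 := by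
    intro i
    have h : ∀ φ, (c.eval φ i) ^ 2 = ∑ τ, ∑ σ, c i τ * c i σ * (trigVec N φ τ * trigVec N φ σ) := by
      intro φ
      rw [eval_eq_pairForm, pairForm_apply, sq, Finset.sum_mul_sum]
      refine Finset.sum_congr rfl fun τ _ => Finset.sum_congr rfl fun σ _ => by ring
    have hcont : ∀ τ, Continuous fun φ => trigVec N φ τ := fun τ =>
      (continuous_apply τ).comp (continuous_trigVec N)
    simp only [h]
    have hi : ∀ τ σ, IntervalIntegrable (fun φ => c i τ * c i σ * (trigVec N φ τ * trigVec N φ σ))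
        volume 0 (2 * Real.pi) := fun τ σ =>
      (continuous_const.mul ((hcont τ).mul (hcont σ))).intervalIntegrable _ _
    have hi' : ∀ τ, IntervalIntegrable
        (fun φ => ∑ σ, c i τ * c i σ * (trigVec N φ τ * trigVec N φ σ))
        volume 0 (2 * Real.pi) := fun τ =>
      (continuous_finsetSum _ fun σ _ =>
        continuous_const.mul ((hcont τ).mul (hcont σ))).intervalIntegrable _ _
    rw [intervalIntegral.integral_finsetSum fun τ _ => hi' τ, Finset.mul_sum]
    refine Finset.sum_congr rfl fun τ _ => ?_
    rw [intervalIntegral.integral_finsetSum fun σ _ => hi τ σ]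
    simp only [intervalIntegral.integral_const_mul, integral_trigVec_mul_trigVec]
    simp
    ring
  have hcont : ∀ i, Continuous fun φ => c.eval φ i ^ 2 := by
    intro i
    simp only [eval_eq_pairForm, pairForm_apply]
    have hcont : ∀ τ, Continuous fun φ => trigVec N φ τ := fun τ =>
      (continuous_apply τ).comp (continuous_trigVec N)
    fun_prop
  rw [l2Norm, intervalIntegral.integral_add ((hcont 0).intervalIntegrable _ _)
    ((hcont 1).intervalIntegrable _ _), key, key, pairSq, Fin.sum_univ_two]
  congr 1
  field_simp

end TrigCurve

end TrigonometricBasis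

/-! ### The Kac–Rice formula for trigonometric curves. -/

namespace TrigCurve

open scoped ENNReal

variable {N : ℕ}

/-- The pairs of parameters at which two curves meet, as vectors with two coordinates. -/
def incidence (p : TrigCurve N × TrigCurve N) : Set (Fin 2 → ℝ) :=
  {x | x ∈ univ.pi (fun _ : Fin 2 => Ico 0 (2 * Real.pi)) ∧ p.1.eval (x 0) = p.2.eval (x 1)}

/-- The number of pairs of parameters at which two curves meet. -/
noncomputable def incidenceCount (p : TrigCurve N × TrigCurve N) : ℝ≥0∞ :=
  (((incidence p).encard : ℕ∞) : ℝ≥0∞)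

theorem continuous_eval : Continuous fun q : TrigCurve N × ℝ => q.1.eval q.2 := by
  refine continuous_pi fun i => ?_
  simp only [eval]
  fun_prop

theorem iUnion_Icc_sub_one_div (a : ℝ) :
    ⋃ m : ℕ, univ.pi (fun _ : Fin 2 => Icc 0 (a - 1 / ((m : ℝ) + 1))) =
      univ.pi (fun _ : Fin 2 => Ico 0 a) := by
  ext x
  simp only [mem_iUnion, mem_univ_pi, mem_Icc, mem_Ico]
  constructor
  · rintro ⟨m, h⟩ i
    have : (0 : ℝ) < 1 / ((m : ℝ) + 1) := by positivity
    exact ⟨(h i).1, by linarith [(h i).2]⟩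
  · intro h
    have h0 : 0 < min (a - x 0) (a - x 1) := lt_min (sub_pos.2 (h 0).2) (sub_pos.2 (h 1).2)
    obtain ⟨m, hm⟩ := exists_nat_one_div_lt h0
    rw [lt_min_iff] at hm
    refine ⟨m, fun i => ⟨(h i).1, ?_⟩⟩
    fin_cases i
    · simp only [Fin.zero_eta]; linarith
    · simp only [Fin.mk_one]; linarith

@[fun_prop]
theorem measurable_incidenceCount : Measurable (incidenceCount (N := N)) := by
  have h := measurable_encard_fiber (X := TrigCurve N × TrigCurve N) (T := Fin 2 → ℝ)
    (K := fun m : ℕ => univ.pi (fun _ : Fin 2 => Icc 0 (2 * Real.pi - 1 / ((m : ℝ) + 1))))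
    (fun m => isCompact_univ_pi fun _ => isCompact_Icc)
    (fun m n hmn => pi_mono fun _ _ => Icc_subset_Icc_right (by gcongr))
    (C := {q | q.1.1.eval (q.2 0) = q.1.2.eval (q.2 1)})
    (isClosed_eq (continuous_eval.comp (f := fun q : (TrigCurve N × TrigCurve N) × (Fin 2 → ℝ) =>
      (q.1.1, q.2 0)) (by fun_prop)) (continuous_eval.comp
      (f := fun q : (TrigCurve N × TrigCurve N) × (Fin 2 → ℝ) => (q.1.2, q.2 1)) (by fun_prop)))
  rw [iUnion_Icc_sub_one_div] at h
  exact h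

/-- The inclusion of the pairs of coefficients of one basis function. -/
noncomputable def coeffInclusion (τ : Fin (N + 1) ⊕ Fin N) : (Fin 2 → ℝ) →L[ℝ] TrigCurve N :=
  ContinuousLinearMap.pi fun i => ContinuousLinearMap.pi fun σ =>
    (if σ = τ then (1 : ℝ) else 0) • ContinuousLinearMap.proj i

theorem coeffInclusion_apply (τ : Fin (N + 1) ⊕ Fin N) (y : Fin 2 → ℝ) (i : Fin 2)
    (σ : Fin (N + 1) ⊕ Fin N) :
    coeffInclusion τ y i σ = if σ = τ then y i else 0 := by
  simp only [coeffInclusion, ContinuousLinearMap.pi_apply]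
  split_ifs <;> simp

theorem pairForm_coeffInclusion (b : Fin (N + 1) ⊕ Fin N → ℝ) (τ : Fin (N + 1) ⊕ Fin N)
    (y : Fin 2 → ℝ) : pairForm b (coeffInclusion τ y) = b τ • y := by
  ext i
  simp [pairForm_apply, coeffInclusion_apply, mul_comm]

variable (N) in
/-- The inclusion of the constant curves. -/
noncomputable def const : (Fin 2 → ℝ) →L[ℝ] TrigCurve N := coeffInclusion (Sum.inl 0)

theorem pairForm_trigVec_const (φ : ℝ) (y : Fin 2 → ℝ) :
    pairForm (trigVec N φ) (const N y) = y := by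
  rw [const, pairForm_coeffInclusion]; simp [trigVec]

theorem pairForm_trigDeriv_const (φ : ℝ) (y : Fin 2 → ℝ) :
    pairForm (trigDeriv N φ) (const N y) = 0 := by
  rw [const, pairForm_coeffInclusion]; simp [trigDeriv]

theorem hasDerivAt_eval (c : TrigCurve N) (φ : ℝ) :
    HasDerivAt c.eval (pairForm (trigDeriv N φ) c) φ := by
  refine hasDerivAt_pi.2 fun i => ?_
  simp only [eval_eq_pairForm, pairForm_apply]
  exact HasDerivAt.fun_sum fun τ _ => (hasDerivAt_trigVec N φ τ).const_mul _

theorem continuous_pairForm_trigDeriv :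
    Continuous fun q : TrigCurve N × ℝ => pairForm (trigDeriv N q.2) q.1 := by
  refine continuous_pi fun i => ?_
  simp only [pairForm_apply]
  have : ∀ τ, Continuous fun φ => trigDeriv N φ τ := fun τ =>
    (continuous_apply τ).comp (continuous_trigDeriv N)
  fun_prop

theorem continuous_pairForm_trigVec :
    Continuous fun q : TrigCurve N × ℝ => pairForm (trigVec N q.2) q.1 := by
  simpa only [eval_eq_pairForm] using continuous_eval (N := N)

/-- The derivative of the difference of the values of two curves. -/
noncomputable def differenceDeriv (f g : TrigCurve N) (x : Fin 2 → ℝ) :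
    (Fin 2 → ℝ) →L[ℝ] (Fin 2 → ℝ) :=
  (ContinuousLinearMap.proj (R := ℝ) (φ := fun _ : Fin 2 => ℝ) 0).smulRight
      (pairForm (trigDeriv N (x 0)) f) -
    (ContinuousLinearMap.proj (R := ℝ) (φ := fun _ : Fin 2 => ℝ) 1).smulRight
      (pairForm (trigDeriv N (x 1)) g)

theorem hasFDerivAt_difference (f g : TrigCurve N) (x : Fin 2 → ℝ) :
    HasFDerivAt (fun x : Fin 2 → ℝ => f.eval (x 0) - g.eval (x 1)) (differenceDeriv f g x) x := by
  have h : ∀ (c : TrigCurve N) (i : Fin 2), HasFDerivAt (fun x : Fin 2 → ℝ => c.eval (x i))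
      ((ContinuousLinearMap.proj (R := ℝ) (φ := fun _ : Fin 2 => ℝ) i).smulRight
        (pairForm (trigDeriv N (x i)) c)) x := by
    intro c i
    refine ((hasDerivAt_eval c (x i)).hasFDerivAt.comp x
      (ContinuousLinearMap.proj (R := ℝ) (φ := fun _ : Fin 2 => ℝ) i).hasFDerivAt).congr_fderiv ?_
    ext v j
    simp
  exact (h f 0).sub (h g 1)

theorem abs_det_differenceDeriv (f g : TrigCurve N) (x : Fin 2 → ℝ) :
    |(differenceDeriv f g x).det| =
      |planeDet (pairForm (trigDeriv N (x 0)) f) (pairForm (trigDeriv N (x 1)) g)| := by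
  set u := pairForm (trigDeriv N (x 0)) f with hu
  set v := pairForm (trigDeriv N (x 1)) g with hv
  have : (differenceDeriv f g x : (Fin 2 → ℝ) →ₗ[ℝ] (Fin 2 → ℝ)) =
      Matrix.toLin' !![u 0, -v 0; u 1, -v 1] := by
    refine LinearMap.ext fun z => ?_
    ext j
    fin_cases j <;>
      simp [differenceDeriv, Matrix.toLin'_apply, Matrix.mulVec, dotProduct, ← hu, ← hv] <;> ring
  rw [ContinuousLinearMap.det, this, LinearMap.det_toLin', Matrix.det_fin_two, ← abs_neg]
  congr 1
  simp [planeDet]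
  ring

theorem continuous_differenceDeriv (f g : TrigCurve N) : Continuous (differenceDeriv f g) := by
  unfold differenceDeriv
  have h : ∀ (c : TrigCurve N) (i : Fin 2), Continuous fun x : Fin 2 → ℝ =>
      (ContinuousLinearMap.proj (R := ℝ) (φ := fun _ : Fin 2 => ℝ) i).smulRight
        (pairForm (trigDeriv N (x i)) c) := fun c i =>
    (ContinuousLinearMap.smulRightL ℝ (Fin 2 → ℝ) (Fin 2 → ℝ)
      (ContinuousLinearMap.proj (R := ℝ) (φ := fun _ : Fin 2 => ℝ) i)).continuous.comp
      (continuous_pairForm_trigDeriv.comp (f := fun x : Fin 2 → ℝ => (c, x i)) (by fun_prop))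
  exact (h f 0).sub (h g 1)

/-- Translating `g` by `y` makes the incidences a fibre of the difference map, to which the area
formula applies. -/
theorem incidence_add_const (f g : TrigCurve N) (y : Fin 2 → ℝ) :
    incidence (f, g + const N y) =
      {x | x ∈ univ.pi (fun _ : Fin 2 => Ico 0 (2 * Real.pi)) ∧ f.eval (x 0) - g.eval (x 1) = y} := by
  ext x
  simp only [incidence, mem_ofPred_eq, eval_eq_pairForm, map_add, pairForm_trigVec_const,
    sub_eq_iff_eq_add']

/-- The Kac–Rice formula for one random curve. -/
theorem lintegral_incidenceCount_mul {ρ : (Fin 2 → ℝ) → ℝ≥0∞} (hρ : Measurable ρ)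
    (hρ1 : ∫⁻ y, ρ y = 1) (f : TrigCurve N) {k : TrigCurve N → ℝ≥0∞} (hk : Measurable k) :
    ∫⁻ g : TrigCurve N, incidenceCount (f, g) * k g =
      ∫⁻ g : TrigCurve N, ∫⁻ x in univ.pi (fun _ : Fin 2 => Ico 0 (2 * Real.pi)),
        ENNReal.ofReal |planeDet (pairForm (trigDeriv N (x 0)) f) (pairForm (trigDeriv N (x 1)) g)| *
          (ρ (f.eval (x 0) - g.eval (x 1)) *
            k (g + const N (f.eval (x 0) - g.eval (x 1)))) := by
  calc ∫⁻ g : TrigCurve N, incidenceCount (f, g) * k g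
      -- Lebesgue measure is invariant under translation of `g` by constant curves, so one may
      -- average over `y` with density `ρ`.
      = ∫⁻ y, ρ y * ∫⁻ g : TrigCurve N, incidenceCount (f, g + const N y) * k (g + const N y) := by
        have : ∀ y, ∫⁻ g : TrigCurve N, incidenceCount (f, g + const N y) * k (g + const N y) =
            ∫⁻ g : TrigCurve N, incidenceCount (f, g) * k g := fun y =>
          lintegral_add_right_eq_self (fun g => incidenceCount (f, g) * k g) (const N y)
        simp only [this]
        rw [lintegral_mul_const _ hρ, hρ1, one_mul]
    _ = ∫⁻ y, ∫⁻ g : TrigCurve N, ρ y * (incidenceCount (f, g + const N y) * k (g + const N y)) := by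
        congr with y
        rw [lintegral_const_mul _ (by fun_prop)]
    _ = ∫⁻ g : TrigCurve N, ∫⁻ y, ρ y * (incidenceCount (f, g + const N y) * k (g + const N y)) := by
        apply lintegral_lintegral_swap
        apply Measurable.aemeasurable
        fun_prop
    _ = _ := by
        congr with g
        have h := lintegral_encard_fiber_mul (volume : Measure (Fin 2 → ℝ))
          (F := fun x => f.eval (x 0) - g.eval (x 1)) (F' := differenceDeriv f g)
          (s := univ.pi (fun _ : Fin 2 => Ico 0 (2 * Real.pi)))
          (MeasurableSet.univ_pi fun _ => measurableSet_Ico) (hasFDerivAt_difference f g)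
          (continuous_differenceDeriv f g).measurable (k := fun y => ρ y * k (g + const N y))
          (by fun_prop)
        simp only [abs_det_differenceDeriv] at h
        rw [← h]
        congr with y
        rw [incidenceCount, incidence_add_const]
        ring

/-- The parameters are made the outermost variables, so that the inner integral becomes the one
computed at a fixed pair of parameters. -/
theorem lintegral_lintegral_incidenceCount_mul_pairBall {ρ : (Fin 2 → ℝ) → ℝ≥0∞}
    (hρ : Measurable ρ) (hρ1 : ∫⁻ y, ρ y = 1) :
    ∫⁻ f : TrigCurve N, ∫⁻ g : TrigCurve N,
        incidenceCount (f, g) * (pairBall (trigWeight N) f * pairBall (trigWeight N) g) =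
      ∫⁻ x in univ.pi (fun _ : Fin 2 => Ico 0 (2 * Real.pi)), ∫⁻ f, ∫⁻ g,
        ρ (pairForm (trigVec N (x 0)) f - pairForm (trigVec N (x 1)) g) *
        (ENNReal.ofReal
          |planeDet (pairForm (trigDeriv N (x 0)) f) (pairForm (trigDeriv N (x 1)) g)| *
          (pairBall (trigWeight N) f * pairBall (trigWeight N)
            (g + const N (pairForm (trigVec N (x 0)) f - pairForm (trigVec N (x 1)) g)))) := by
  have hd : ∀ i : Fin 2, Measurable fun q : (TrigCurve N × TrigCurve N) × (Fin 2 → ℝ) =>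
      pairForm (trigDeriv N (q.2 i)) q.1.1 := fun i =>
    (continuous_pairForm_trigDeriv.comp (f := fun q : (TrigCurve N × TrigCurve N) × (Fin 2 → ℝ) =>
      (q.1.1, q.2 i)) (by fun_prop)).measurable
  have hd' : ∀ i : Fin 2, Measurable fun q : (TrigCurve N × TrigCurve N) × (Fin 2 → ℝ) =>
      pairForm (trigDeriv N (q.2 i)) q.1.2 := fun i =>
    (continuous_pairForm_trigDeriv.comp (f := fun q : (TrigCurve N × TrigCurve N) × (Fin 2 → ℝ) =>
      (q.1.2, q.2 i)) (by fun_prop)).measurable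
  have hv : ∀ i : Fin 2, Measurable fun q : (TrigCurve N × TrigCurve N) × (Fin 2 → ℝ) =>
      pairForm (trigVec N (q.2 i)) q.1.1 := fun i =>
    (continuous_pairForm_trigVec.comp (f := fun q : (TrigCurve N × TrigCurve N) × (Fin 2 → ℝ) =>
      (q.1.1, q.2 i)) (by fun_prop)).measurable
  have hv' : ∀ i : Fin 2, Measurable fun q : (TrigCurve N × TrigCurve N) × (Fin 2 → ℝ) =>
      pairForm (trigVec N (q.2 i)) q.1.2 := fun i =>
    (continuous_pairForm_trigVec.comp (f := fun q : (TrigCurve N × TrigCurve N) × (Fin 2 → ℝ) =>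
      (q.1.2, q.2 i)) (by fun_prop)).measurable
  have hdd := measurable_planeDet (hd 0) (hd' 1)
  have hvv := (hv 0).sub (hv' 1)
  set Φ : (TrigCurve N × TrigCurve N) × (Fin 2 → ℝ) → ℝ≥0∞ := fun q =>
    ρ (pairForm (trigVec N (q.2 0)) q.1.1 - pairForm (trigVec N (q.2 1)) q.1.2) *
        (ENNReal.ofReal
          |planeDet (pairForm (trigDeriv N (q.2 0)) q.1.1) (pairForm (trigDeriv N (q.2 1)) q.1.2)| *
          (pairBall (trigWeight N) q.1.1 * pairBall (trigWeight N) (q.1.2 +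
            const N (pairForm (trigVec N (q.2 0)) q.1.1 - pairForm (trigVec N (q.2 1)) q.1.2))))
    with hΦ
  have hΦm : Measurable Φ := by
    refine (hρ.comp hvv).mul ((ENNReal.measurable_ofReal.comp
      (continuous_abs.measurable.comp hdd)).mul (Measurable.mul (by fun_prop) ?_))
    exact measurable_pairBall.comp (Measurable.add (by fun_prop)
      ((const N).measurable.comp hvv))
  calc ∫⁻ f : TrigCurve N, ∫⁻ g : TrigCurve N,
        incidenceCount (f, g) * (pairBall (trigWeight N) f * pairBall (trigWeight N) g)
      = ∫⁻ f, ∫⁻ g, ∫⁻ x in univ.pi (fun _ : Fin 2 => Ico 0 (2 * Real.pi)), Φ ((f, g), x) := by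
        congr with f
        rw [lintegral_incidenceCount_mul hρ hρ1 f (by fun_prop)]
        congr with g
        congr with x
        simp only [eval_eq_pairForm, hΦ]
        ring
    _ = ∫⁻ f, ∫⁻ x in univ.pi (fun _ : Fin 2 => Ico 0 (2 * Real.pi)), ∫⁻ g, Φ ((f, g), x) := by
        congr with f
        apply lintegral_lintegral_swap
        apply Measurable.aemeasurable
        exact hΦm.comp (g := Φ) (f := fun z : TrigCurve N × (Fin 2 → ℝ) => ((f, z.1), z.2))
          (by fun_prop)
    _ = _ := by
        apply lintegral_lintegral_swap
        apply Measurable.aemeasurable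
        exact Measurable.lintegral_prod_right' (f := fun z : (TrigCurve N × (Fin 2 → ℝ)) ×
          TrigCurve N => Φ ((z.1.1, z.2), z.1.2)) (hΦm.comp (by fun_prop))

theorem volume_parameters :
    volume (univ.pi (fun _ : Fin 2 => Ico 0 (2 * Real.pi))) =
      ENNReal.ofReal ((2 * Real.pi) ^ 2) := by
  rw [Real.volume_pi_Ico, Fin.prod_univ_two, sub_zero,
    ← ENNReal.ofReal_mul (by positivity), sq]

theorem lintegral_incidenceCount_mul_pairBall (hN : N ≠ 0) :
    ∫⁻ f : TrigCurve N, ∫⁻ g : TrigCurve N,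
        incidenceCount (f, g) * (pairBall (trigWeight N) f * pairBall (trigWeight N) g) =
      ENNReal.ofReal ((2 * Real.pi) ^ 2) *
      (ENNReal.ofReal (Real.pi * (N + 1 / 2) / (2 * (2 * N + 1))) *
        (pairGaussianMass (trigWeight N) / ENNReal.ofReal
          (Real.Gamma (2 * N + 1 + 1 / 2) * (Real.pi * (N + 1 / 2)) *
            (Real.pi * ∑ j ∈ Finset.Icc 1 N, (j : ℝ) ^ 2))) ^ 2 *
        ENNReal.ofReal ((Real.pi * ∑ j ∈ Finset.Icc 1 N, (j : ℝ) ^ 2) ^ 2 *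
          ((∑ j ∈ Finset.Icc 1 N, (j : ℝ) ^ 2) / 2))) := by
  obtain ⟨ρ, hρ, hρ1⟩ := exists_density (Fin 2 → ℝ) volume
  have hS : 0 < ∑ j ∈ Finset.Icc 1 N, (j : ℝ) ^ 2 :=
    Finset.sum_pos (fun j hj => by
      have : 0 < j := (Finset.mem_Icc.1 hj).1
      positivity) ⟨1, by simp; omega⟩
  have hκ : (0 : ℝ) < N + 1 / 2 := by positivity
  have hcard : (Fintype.card (Fin (N + 1) ⊕ Fin N) : ℝ) = 2 * N + 1 := by
    simp; ring
  rw [lintegral_lintegral_incidenceCount_mul_pairBall hρ hρ1]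
  have h : ∀ x : Fin 2 → ℝ, _ := fun x => lintegral_lintegral_incidence (w := trigWeight N)
    (trigWeight_pos N) hκ hS
    (sum_trigVec_sq N (x 0)) (sum_trigVec_mul_trigDeriv N (x 0)) (sum_trigDeriv_sq N (x 0))
    (sum_trigVec_sq N (x 1)) (sum_trigVec_mul_trigDeriv N (x 1)) (sum_trigDeriv_sq N (x 1))
    hρ hρ1 (c := const N) (pairForm_trigVec_const (x 1)) (pairForm_trigDeriv_const (x 1))
  simp only [h, hcard]
  rw [setLIntegral_const, volume_parameters, mul_comm]

end TrigCurve

/-! ### Double points, and intersection points versus parameter pairs. -/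

namespace TrigCurve

open scoped ENNReal

variable {N : ℕ}

set_option synthInstance.maxSize 512 in
instance isAddHaarMeasure_volume : (volume : Measure (TrigCurve N)).IsAddHaarMeasure :=
  inferInstance

instance isAddHaarMeasure_volume_plane_prod :
    (volume : Measure ((Fin 2 → ℝ) × (Fin 2 → ℝ))).IsAddHaarMeasure :=
  Measure.prod.instIsAddHaarMeasure _ _

instance isAddHaarMeasure_volume_prod :
    (volume : Measure (TrigCurve N × TrigCurve N)).IsAddHaarMeasure :=
  Measure.prod.instIsAddHaarMeasure _ _

/-- The pairs of curves of which the second one passes through a double point of the first one,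
where the double point is detected by the given basis function. -/
def doublePointIncidence (τ : Fin (N + 1) ⊕ Fin N) : Set (TrigCurve N × TrigCurve N) :=
  {p | ∃ x : Fin 3 → ℝ, trigVec N (x 0) τ ≠ trigVec N (x 1) τ ∧
    p.1.eval (x 0) = p.1.eval (x 1) ∧ p.1.eval (x 0) = p.2.eval (x 2)}

theorem measurableSet_doublePointIncidence (τ : Fin (N + 1) ⊕ Fin N) :
    MeasurableSet (doublePointIncidence τ) := by
  have hτ : Continuous fun φ => trigVec N φ τ := (continuous_apply τ).comp (continuous_trigVec N)
  have h1 : ∀ i : Fin 3, Continuous fun q : (TrigCurve N × TrigCurve N) × (Fin 3 → ℝ) =>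
      q.1.1.eval (q.2 i) := fun i => continuous_eval.comp
    (f := fun q : (TrigCurve N × TrigCurve N) × (Fin 3 → ℝ) => (q.1.1, q.2 i)) (by fun_prop)
  have h2 : ∀ i : Fin 3, Continuous fun q : (TrigCurve N × TrigCurve N) × (Fin 3 → ℝ) =>
      q.1.2.eval (q.2 i) := fun i => continuous_eval.comp
    (f := fun q : (TrigCurve N × TrigCurve N) × (Fin 3 → ℝ) => (q.1.2, q.2 i)) (by fun_prop)
  -- Bounding the parameters and the separation makes each piece a projection of a closed set along
  -- a compact cube.
  have : doublePointIncidence τ = ⋃ m : ℕ, {p | ∃ x ∈ univ.pi fun _ : Fin 3 => Icc (-(m : ℝ)) m,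
      (p, x) ∈ {q : (TrigCurve N × TrigCurve N) × (Fin 3 → ℝ) |
        1 / ((m : ℝ) + 1) ≤ |trigVec N (q.2 0) τ - trigVec N (q.2 1) τ| ∧
          q.1.1.eval (q.2 0) = q.1.1.eval (q.2 1) ∧ q.1.1.eval (q.2 0) = q.1.2.eval (q.2 2)}} := by
    ext p
    simp only [doublePointIncidence, mem_ofPred_eq, mem_iUnion, mem_univ_pi]
    constructor
    · rintro ⟨x, hx, he⟩
      obtain ⟨m, hm⟩ := exists_nat_one_div_lt (abs_pos.2 (sub_ne_zero.2 hx))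
      obtain ⟨M, hM⟩ := exists_nat_ge ‖x‖
      refine ⟨m + M, x, fun i => ?_, ?_, he⟩
      · have h := (norm_le_pi_norm x i).trans hM
        rw [Real.norm_eq_abs, abs_le] at h
        push_cast
        have : (0 : ℝ) ≤ m := Nat.cast_nonneg m
        exact ⟨by linarith [h.1], by linarith [h.2]⟩
      · refine le_trans ?_ hm.le
        have : (m : ℝ) ≤ (m + M : ℕ) := by exact_mod_cast Nat.le_add_right m M
        gcongr
    · rintro ⟨m, x, -, hx, he⟩
      refine ⟨x, fun h => ?_, he⟩
      rw [h, sub_self, abs_zero] at hx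
      have : (0 : ℝ) < 1 / ((m : ℝ) + 1) := by positivity
      linarith
  rw [this]
  refine MeasurableSet.iUnion fun m => IsClosed.measurableSet ?_
  refine IsClosed.setOf_exists_mem_compact (isCompact_univ_pi fun _ => isCompact_Icc) ?_
  have h3 : ∀ i : Fin 3, Continuous fun q : (TrigCurve N × TrigCurve N) × (Fin 3 → ℝ) =>
      trigVec N (q.2 i) τ := fun i => hτ.comp (by fun_prop)
  exact (isClosed_le continuous_const ((h3 0).sub (h3 1)).abs).inter
    ((isClosed_eq (h1 0) (h1 1)).inter (isClosed_eq (h1 0) (h2 2)))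

theorem differentiable_eval (c : TrigCurve N) : Differentiable ℝ c.eval := fun φ =>
  (hasDerivAt_eval c φ).differentiableAt

/-- Perturb `f` by `s` times the basis function `τ` and `g` by a constant `t`. For given parameters
the double point equation determines `s` and the incidence then determines `t`, so the bad `(s, t)`
in a four-dimensional space depend differentiably on three parameters and form a null set. This
holds around every `(f, g)`, which suffices by Fubini. -/
theorem ae_notMem_doublePointIncidence (τ : Fin (N + 1) ⊕ Fin N) :
    ∀ᵐ p : TrigCurve N × TrigCurve N, p ∉ doublePointIncidence τ := by
  let L : ((Fin 2 → ℝ) × (Fin 2 → ℝ)) →ₗ[ℝ] TrigCurve N × TrigCurve N :=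
    ((coeffInclusion τ).prodMap (const N) : _ →L[ℝ] _)
  have hL : ∀ s t, L (s, t) = (coeffInclusion τ s, const N t) := fun s t => rfl
  refine ae_mem_of_ae_add_linearMap_mem L (volume : Measure ((Fin 2 → ℝ) × (Fin 2 → ℝ)))
    (volume : Measure (TrigCurve N × TrigCurve N))
    (measurableSet_doublePointIncidence τ).compl ?_
  rintro ⟨f, g⟩
  -- A fourth coordinate, fixed at zero, equalises the dimensions: differentiable maps send null
  -- sets to null sets.
  set U : Set ((Fin 2 → ℝ) × (Fin 2 → ℝ)) :=
    {q | trigVec N (q.1 0) τ ≠ trigVec N (q.1 1) τ ∧ q.2 1 = 0} with hU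
  set H : ((Fin 2 → ℝ) × (Fin 2 → ℝ)) → (Fin 2 → ℝ) := fun q =>
    (trigVec N (q.1 0) τ - trigVec N (q.1 1) τ)⁻¹ • (f.eval (q.1 1) - f.eval (q.1 0)) with hH
  set Ψ : ((Fin 2 → ℝ) × (Fin 2 → ℝ)) → ((Fin 2 → ℝ) × (Fin 2 → ℝ)) := fun q =>
    (H q, f.eval (q.1 0) + trigVec N (q.1 0) τ • H q - g.eval (q.2 0)) with hΨ
  have hUnull : volume U = 0 := by
    refine measure_mono_null (t := univ ×ˢ {z : Fin 2 → ℝ | z 1 = 0}) (fun q hq => ⟨trivial, hq.2⟩) ?_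
    have h0 : volume {z : Fin 2 → ℝ | z 1 = 0} = 0 :=
      Measure.pi_hyperplane (fun _ : Fin 2 => (volume : Measure ℝ)) 1 0
    rw [Measure.volume_eq_prod, Measure.prod_prod, h0, mul_zero]
  have hτ : Differentiable ℝ fun φ => trigVec N φ τ := fun φ =>
    (hasDerivAt_trigVec N φ τ).differentiableAt
  have hf : ∀ i, Differentiable ℝ fun q : (Fin 2 → ℝ) × (Fin 2 → ℝ) => f.eval (q.1 i) := fun i =>
    (differentiable_eval f).comp (by fun_prop)
  have hg : ∀ i, Differentiable ℝ fun q : (Fin 2 → ℝ) × (Fin 2 → ℝ) => g.eval (q.2 i) := fun i =>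
    (differentiable_eval g).comp (by fun_prop)
  have hv : ∀ i, Differentiable ℝ fun q : (Fin 2 → ℝ) × (Fin 2 → ℝ) => trigVec N (q.1 i) τ :=
    fun i => hτ.comp (by fun_prop)
  have hHd : ∀ q ∈ U, DifferentiableAt ℝ H q := fun q hq =>
    (((hv 0 q).sub (hv 1 q)).inv (sub_ne_zero.2 hq.1)).smul ((hf 1 q).sub (hf 0 q))
  have hΨd : DifferentiableOn ℝ Ψ U := fun q hq =>
    ((hHd q hq).prodMk (((hf 0 q).add ((hv 0 q).smul (hHd q hq))).sub
      (hg 0 q))).differentiableWithinAt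
  have hnull := addHaar_image_eq_zero_of_differentiableOn_of_addHaar_eq_zero volume hΨd hUnull
  filter_upwards [measure_eq_zero_iff_ae_notMem.1 hnull] with q hq hmem
  refine hq ?_
  obtain ⟨s, t⟩ := q
  obtain ⟨x, hx, h1, h2⟩ := hmem
  simp only [hL, Prod.mk_add_mk, eval_eq_pairForm, map_add, pairForm_coeffInclusion,
    pairForm_trigVec_const] at h1 h2
  simp only [← eval_eq_pairForm] at h1 h2
  have hs : s = H (![x 0, x 1], ![x 2, 0]) := by
    simp only [hH, Matrix.cons_val_zero, Matrix.cons_val_one]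
    rw [eq_inv_smul_iff₀ (sub_ne_zero.2 hx), sub_smul, sub_eq_sub_iff_add_eq_add, add_comm, h1,
      add_comm]
  refine ⟨(![x 0, x 1], ![x 2, 0]), ⟨by simpa using hx, by simp⟩, ?_⟩
  simp only [hΨ, ← hs, Matrix.cons_val_zero]
  rw [h2, add_sub_cancel_left]

theorem eval_add_int_mul (c : TrigCurve N) (φ : ℝ) (k : ℤ) :
    c.eval (φ + k * (2 * Real.pi)) = c.eval φ := by
  ext i
  simp only [eval]
  congr 1
  · refine Finset.sum_congr rfl fun j _ => ?_
    have : ((j : ℕ) : ℝ) * (φ + k * (2 * Real.pi)) =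
        (j : ℕ) * φ + ((((j : ℕ) : ℤ) * k : ℤ) : ℝ) * (2 * Real.pi) := by push_cast; ring
    rw [this, Real.cos_add_int_mul_two_pi]
  · refine Finset.sum_congr rfl fun j _ => ?_
    have : (((j : ℕ) : ℝ) + 1) * (φ + k * (2 * Real.pi)) =
        ((j : ℕ) + 1) * φ + (((((j : ℕ) : ℤ) + 1) * k : ℤ) : ℝ) * (2 * Real.pi) := by
      push_cast; ring
    rw [this, Real.sin_add_int_mul_two_pi]

theorem exists_mem_Ico_eval_eq (c : TrigCurve N) (φ : ℝ) :
    ∃ θ ∈ Ico 0 (2 * Real.pi), c.eval θ = c.eval φ := by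
  refine ⟨toIcoMod Real.two_pi_pos 0 φ, by simpa using toIcoMod_mem_Ico Real.two_pi_pos 0 φ, ?_⟩
  rw [← eval_add_int_mul c _ (toIcoDiv Real.two_pi_pos 0 φ), ← zsmul_eq_mul,
    toIcoMod_add_toIcoDiv_zsmul]

theorem intersectionPoints_eq_image (p : TrigCurve N × TrigCurve N) :
    intersectionPoints p = (fun t : ℝ × ℝ => p.1.eval t.1) '' intersectionParams p := by
  ext y
  constructor
  · rintro ⟨⟨φ, hφ⟩, ⟨ψ, hψ⟩⟩
    obtain ⟨φ', h1, h1'⟩ := exists_mem_Ico_eval_eq p.1 φ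
    obtain ⟨ψ', h2, h2'⟩ := exists_mem_Ico_eval_eq p.2 ψ
    exact ⟨(φ', ψ'), ⟨h1, h2, by rw [h1', h2', hφ, hψ]⟩, h1'.trans hφ⟩
  · rintro ⟨t, ⟨-, -, h⟩, rfl⟩
    exact ⟨⟨t.1, rfl⟩, ⟨t.2, h.symm⟩⟩

theorem encard_intersectionParams (p : TrigCurve N × TrigCurve N) :
    (intersectionParams p).encard = (incidence p).encard := by
  have : intersectionParams p = (fun x : Fin 2 → ℝ => (x 0, x 1)) '' incidence p := by
    ext ⟨φ, ψ⟩
    constructor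
    · rintro ⟨h1, h2, h⟩
      refine ⟨![φ, ψ], ⟨fun i _ => ?_, by simpa using h⟩, by simp⟩
      fin_cases i
      · simpa using h1
      · simpa using h2
    · rintro ⟨x, ⟨hx, h⟩, he⟩
      rw [Prod.mk.injEq] at he
      obtain ⟨rfl, rfl⟩ := he
      exact ⟨hx 0 trivial, hx 1 trivial, h⟩
  rw [this]
  refine Function.Injective.encard_image (fun x y h => ?_) _
  rw [Prod.mk.injEq] at h
  ext i
  fin_cases i
  · exact h.1
  · exact h.2

theorem eq_of_cos_eq_of_sin_eq {φ ψ : ℝ} (hφ : φ ∈ Ico 0 (2 * Real.pi))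
    (hψ : ψ ∈ Ico 0 (2 * Real.pi)) (hc : Real.cos φ = Real.cos ψ) (hs : Real.sin φ = Real.sin ψ) :
    φ = ψ := by
  obtain ⟨k, hk⟩ := Real.Angle.angle_eq_iff_two_pi_dvd_sub.1 (Real.Angle.cos_sin_inj hc hs)
  have h2 := Real.two_pi_pos
  have h3 : (-1 : ℝ) < k := by
    by_contra! h
    nlinarith [hφ.1, hψ.2]
  have h4 : (k : ℝ) < 1 := by
    by_contra! h
    nlinarith [hφ.2, hψ.1]
  have h5 : k = 0 := by
    have : (-1 : ℤ) < k := by exact_mod_cast h3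
    have : k < (1 : ℤ) := by exact_mod_cast h4
    omega
  rw [h5] at hk
  simp at hk
  linarith

theorem eq_of_eval_eq_of_notMem (hN : N ≠ 0) {p : TrigCurve N × TrigCurve N}
    (hp : ∀ τ, p ∉ doublePointIncidence τ) {φ φ' ψ : ℝ} (hφ : φ ∈ Ico 0 (2 * Real.pi))
    (hφ' : φ' ∈ Ico 0 (2 * Real.pi)) (h : p.1.eval φ = p.1.eval φ')
    (h' : p.1.eval φ = p.2.eval ψ) : φ = φ' := by
  have hall : ∀ τ, trigVec N φ τ = trigVec N φ' τ := fun τ => by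
    by_contra hne
    exact hp τ ⟨![φ, φ', ψ], by simpa using hne, by simpa using h, by simpa using h'⟩
  refine eq_of_cos_eq_of_sin_eq hφ hφ' ?_ ?_
  -- Agreement of `cos φ` and `sin φ` suffices; both belong to the basis because `N ≥ 1`.
  · have := hall (Sum.inl ⟨1, by omega⟩)
    simpa [trigVec] using this
  · have := hall (Sum.inr ⟨0, by omega⟩)
    simpa [trigVec] using this

theorem ae_ncard_intersectionPoints (hN : N ≠ 0) :
    ∀ᵐ p : TrigCurve N × TrigCurve N,
      (intersectionPoints p).ncard = (intersectionParams p).ncard := by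
  have h1 : ∀ᵐ p : TrigCurve N × TrigCurve N, ∀ τ, p ∉ doublePointIncidence τ :=
    ae_all_iff.2 ae_notMem_doublePointIncidence
  -- The exchanged statement is needed for the uniqueness of the second parameter.
  have h2 : ∀ᵐ p : TrigCurve N × TrigCurve N, ∀ τ, p.swap ∉ doublePointIncidence τ :=
    (Measure.measurePreserving_swap (μ := (volume : Measure (TrigCurve N)))
      (ν := (volume : Measure (TrigCurve N)))).quasiMeasurePreserving.ae h1
  filter_upwards [h1, h2] with p hp hp'
  rw [intersectionPoints_eq_image]
  refine InjOn.ncard_image ?_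
  rintro ⟨φ, ψ⟩ ⟨hφ, hψ, h⟩ ⟨φ', ψ'⟩ ⟨hφ', hψ', h'⟩ heq
  simp only at heq h h' hφ hψ hφ' hψ'
  refine Prod.ext (eq_of_eval_eq_of_notMem hN hp hφ hφ' heq h)
    (eq_of_eval_eq_of_notMem (p := p.swap) hN hp' hψ hψ' (ψ := φ) ?_ h.symm)
  exact h.symm.trans (heq.trans h')

end TrigCurve

/-! ### The constant, scaling invariance, and the passage to general densities. -/

namespace TrigCurve

open scoped ENNReal

variable {N : ℕ}

/-- Legendre's duplication formula turns the Gamma value at the half-integer into `(4N+1)! √π /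
((2N)! 2^(4N+1))`; then all powers of `π` and `N + 1/2` cancel and one factor `S` remains. -/
theorem kacRice_constant (N : ℕ) {S : ℝ} (hS : 0 < S) :
    (2 * Real.pi) ^ 2 * (Real.pi * (N + 1 / 2) / (2 * (2 * N + 1)) *
        (Real.Gamma (2 * N + 1 + 1) / (Real.Gamma (2 * N + 1 + 1 / 2) * (Real.pi * (N + 1 / 2)) *
            (Real.pi * S))) ^ 2 * ((Real.pi * S) ^ 2 * (S / 2))) =
      (2 : ℝ) ^ (8 * N + 3) * (Nat.factorial (2 * N) : ℝ) ^ 4 /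
        (Nat.factorial (4 * N + 1) : ℝ) ^ 2 * S := by
  have h1 : Real.Gamma (2 * N + 1 + 1) = (2 * N + 1) * Nat.factorial (2 * N) := by
    have := Real.Gamma_nat_eq_factorial (2 * N)
    push_cast at this
    rw [Real.Gamma_add_one (by positivity), this]
  have h2 : (Nat.factorial (2 * N) : ℝ) * Real.Gamma (2 * N + 1 + 1 / 2) * 2 ^ (4 * N + 1) =
      Nat.factorial (4 * N + 1) * √Real.pi := by
    have h := Real.Gamma_mul_Gamma_add_half (2 * N + 1)
    have e1 := Real.Gamma_nat_eq_factorial (2 * N)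
    have e2 := Real.Gamma_nat_eq_factorial (4 * N + 1)
    push_cast at e1 e2
    have e3 : (2 : ℝ) * (2 * N + 1) = 4 * N + 1 + 1 := by ring
    have e4 : (1 : ℝ) - (4 * N + 1 + 1) = -((4 * N + 1 : ℕ) : ℝ) := by push_cast; ring
    rw [e1, e3, e2, e4, Real.rpow_neg two_pos.le, Real.rpow_natCast] at h
    rw [h]
    field_simp
  have hG : Real.Gamma (2 * N + 1 + 1 / 2) =
      Nat.factorial (4 * N + 1) * √Real.pi / (Nat.factorial (2 * N) * 2 ^ (4 * N + 1)) := by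
    rw [eq_div_iff (by positivity), ← h2]; ring
  have hpi : √Real.pi ^ 2 = Real.pi := Real.sq_sqrt Real.pi_pos.le
  have hpow : (2 : ℝ) ^ (8 * N + 3) = 2 * (2 ^ (4 * N + 1)) ^ 2 := by
    rw [← pow_mul, ← pow_succ']; congr 1; ring
  have hN : (N : ℝ) + 1 / 2 = (2 * N + 1) / 2 := by ring
  rw [h1, hG, hpow, hN]
  have : (0 : ℝ) < 2 * N + 1 := by positivity
  have hπ := Real.pi_pos
  have hsπ : 0 < √Real.pi := Real.sqrt_pos.2 hπ
  generalize (2 : ℝ) ^ (4 * N + 1) = P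
  generalize (2 * (N : ℝ) + 1) = n at *
  have hf : (0 : ℝ) < Nat.factorial (4 * N + 1) := by positivity
  have hf' : (0 : ℝ) < Nat.factorial (2 * N) := by positivity
  -- The generalised power has lost its positivity, but both sides vanish when it is zero.
  by_cases hP : P = 0
  · simp [hP]
  · field_simp
    exact hpi.symm

theorem measurable_l2Norm : Measurable (l2Norm (N := N)) := by
  have : l2Norm (N := N) = fun c => √(pairSq (trigWeight N) c) := by
    ext c; exact l2Norm_eq_sqrt_pairSq c
  rw [this]; fun_prop

theorem l2Norm_nonneg (c : TrigCurve N) : 0 ≤ c.l2Norm := Real.sqrt_nonneg _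

theorem l2Norm_smul {r : ℝ} (hr : 0 ≤ r) (c : TrigCurve N) : (r • c).l2Norm = r * c.l2Norm := by
  rw [l2Norm_eq_sqrt_pairSq, l2Norm_eq_sqrt_pairSq, pairSq_smul, Real.sqrt_mul (sq_nonneg r),
    Real.sqrt_sq hr]

/-- The maximum of the norms of two curves. -/
noncomputable def maxNorm (p : TrigCurve N × TrigCurve N) : ℝ := max p.1.l2Norm p.2.l2Norm

@[fun_prop]
theorem measurable_maxNorm : Measurable (maxNorm (N := N)) :=
  (measurable_l2Norm.comp measurable_fst).max (measurable_l2Norm.comp measurable_snd)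

theorem maxNorm_nonneg (p : TrigCurve N × TrigCurve N) : 0 ≤ maxNorm p :=
  (l2Norm_nonneg p.1).trans (le_max_left _ _)

theorem maxNorm_smul {r : ℝ} (hr : 0 ≤ r) (p : TrigCurve N × TrigCurve N) :
    maxNorm (r • p) = r * maxNorm p := by
  simp only [maxNorm, Prod.smul_fst, Prod.smul_snd, l2Norm_smul hr, mul_max_of_nonneg _ _ hr]

theorem measurableSet_maxNorm_lt (t : ℝ) :
    MeasurableSet {p : TrigCurve N × TrigCurve N | maxNorm p < t} :=
  measurableSet_lt measurable_maxNorm measurable_const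

theorem incidenceCount_smul {r : ℝ} (hr : r ≠ 0) (p : TrigCurve N × TrigCurve N) :
    incidenceCount (r • p) = incidenceCount p := by
  have : incidence (r • p) = incidence p := by
    ext x
    simp only [incidence, mem_ofPred_eq, Prod.smul_fst, Prod.smul_snd, eval_eq_pairForm, map_smul]
    rw [(smul_right_injective _ hr).eq_iff]
  rw [incidenceCount, this, incidenceCount]

theorem setLIntegral_maxNorm_lt {G : TrigCurve N × TrigCurve N → ℝ≥0∞} (hG : Measurable G)
    (hGr : ∀ r : ℝ, 0 < r → ∀ p, G (r • p) = G p) {t : ℝ} (ht : 0 < t) :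
    ∫⁻ p in {p | maxNorm p < t}, G p =
      ENNReal.ofReal (t ^ Module.finrank ℝ (TrigCurve N × TrigCurve N)) *
        ∫⁻ p in {p | maxNorm p < 1}, G p := by
  rw [← lintegral_indicator (measurableSet_maxNorm_lt t),
    ← lintegral_indicator (measurableSet_maxNorm_lt 1),
    ← lintegral_comp_smul_of_pos volume ht (hG.indicator (measurableSet_maxNorm_lt t))]
  congr 2
  ext p
  have : maxNorm (t • p) < t ↔ maxNorm p < 1 := by
    rw [maxNorm_smul ht.le, mul_lt_iff_lt_one_right ht]
  simp only [indicator, mem_ofPred_eq, this, hGr t ht]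

theorem maxNorm_lt_one_iff (p : TrigCurve N × TrigCurve N) :
    maxNorm p < 1 ↔ pairSq (trigWeight N) p.1 < 1 ∧ pairSq (trigWeight N) p.2 < 1 := by
  rw [maxNorm, max_lt_iff, l2Norm_eq_sqrt_pairSq, l2Norm_eq_sqrt_pairSq,
    Real.sqrt_lt' one_pos, Real.sqrt_lt' one_pos, one_pow]

theorem volume_maxNorm_lt_one :
    volume {p : TrigCurve N × TrigCurve N | maxNorm p < 1} =
      volume {f : TrigCurve N | pairSq (trigWeight N) f < 1} ^ 2 := by
  have : {p : TrigCurve N × TrigCurve N | maxNorm p < 1} =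
      {f | pairSq (trigWeight N) f < 1} ×ˢ {f | pairSq (trigWeight N) f < 1} := by
    ext p
    exact maxNorm_lt_one_iff p
  rw [this, Measure.volume_eq_prod, Measure.prod_prod, sq]

theorem volume_pairSq_lt_one_ne_top :
    volume {f : TrigCurve N | pairSq (trigWeight N) f < 1} ≠ ∞ := by
  refine ne_top_of_le_ne_top (measure_ball_lt_top (x := (0 : TrigCurve N)) (r := 1)).ne
    (measure_mono fun f hf => ?_)
  rw [mem_ball_zero_iff, pi_norm_lt_iff one_pos]
  intro i
  rw [pi_norm_lt_iff one_pos]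
  intro τ
  -- All weights are at least one, so the ball lies in the unit cube.
  have hw : 1 ≤ trigWeight N τ := by
    rcases τ with j | j
    · simp only [trigWeight, Sum.elim_inl]; split_ifs <;> norm_num
    · simp [trigWeight]
  have h1 : trigWeight N τ * f i τ ^ 2 ≤ pairSq (trigWeight N) f := by
    have hn : ∀ i τ, 0 ≤ trigWeight N τ * f i τ ^ 2 := fun i τ =>
      mul_nonneg (trigWeight_pos N τ).le (sq_nonneg _)
    exact (Finset.single_le_sum (f := fun τ => trigWeight N τ * f i τ ^ 2) (fun τ _ => hn i τ)
      (Finset.mem_univ τ)).trans (Finset.single_le_sum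
      (f := fun i => ∑ τ, trigWeight N τ * f i τ ^ 2)
      (fun i _ => Finset.sum_nonneg fun τ _ => hn i τ) (Finset.mem_univ i))
  have hf' : pairSq (trigWeight N) f < 1 := hf
  rw [Real.norm_eq_abs, ← sq_lt_one_iff_abs_lt_one]
  nlinarith [sq_nonneg (f i τ)]

theorem volume_maxNorm_lt_one_ne_top :
    volume {p : TrigCurve N × TrigCurve N | maxNorm p < 1} ≠ ∞ := by
  rw [volume_maxNorm_lt_one]
  exact ENNReal.pow_ne_top volume_pairSq_lt_one_ne_top

variable (N) in
/-- The mean number of intersections. -/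
noncomputable def meanCount : ℝ :=
  (2 : ℝ) ^ (8 * N + 3) * (Nat.factorial (2 * N) : ℝ) ^ 4 /
    (Nat.factorial (4 * N + 1) : ℝ) ^ 2 * ∑ j ∈ Finset.Icc 1 N, (j : ℝ) ^ 2

theorem lintegral_incidenceCount_maxNorm_lt_one_eq :
    ∫⁻ p in {p : TrigCurve N × TrigCurve N | maxNorm p < 1}, incidenceCount p =
      ∫⁻ f : TrigCurve N, ∫⁻ g : TrigCurve N,
        incidenceCount (f, g) * (pairBall (trigWeight N) f * pairBall (trigWeight N) g) := by
  rw [← lintegral_indicator (measurableSet_maxNorm_lt 1), Measure.volume_eq_prod,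
    lintegral_prod _ (measurable_incidenceCount.indicator
      (measurableSet_maxNorm_lt 1)).aemeasurable]
  congr with f
  congr with g
  have h := maxNorm_lt_one_iff (f, g)
  simp only [indicator, mem_ofPred_eq, h, pairBall, Pi.one_apply]
  by_cases h1 : pairSq (trigWeight N) f < 1 <;> by_cases h2 : pairSq (trigWeight N) g < 1 <;>
    simp [h1, h2]

theorem trigDeriv_zero (φ : ℝ) : trigDeriv 0 φ = 0 := by
  ext τ
  rcases τ with j | j
  · simp [trigDeriv]
  · exact j.elim0

theorem lintegral_incidenceCount_maxNorm_lt_one :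
    ∫⁻ p in {p : TrigCurve N × TrigCurve N | maxNorm p < 1}, incidenceCount p =
      ENNReal.ofReal (meanCount N) * volume {p : TrigCurve N × TrigCurve N | maxNorm p < 1} := by
  rw [lintegral_incidenceCount_maxNorm_lt_one_eq]
  by_cases hN : N = 0
  -- Here `S = 0`, which the fibre computation excludes, but all derivatives vanish and so does the
  -- Kac–Rice integral.
  · subst hN
    obtain ⟨ρ, hρ, hρ1⟩ := exists_density (Fin 2 → ℝ) volume
    rw [lintegral_lintegral_incidenceCount_mul_pairBall hρ hρ1]
    have h0 : ∀ c : TrigCurve 0, pairForm (0 : Fin (0 + 1) ⊕ Fin 0 → ℝ) c = 0 := fun c => by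
      ext i; simp [pairForm_apply]
    simp [trigDeriv_zero, h0, planeDet, meanCount]
  · have hS : 0 < ∑ j ∈ Finset.Icc 1 N, (j : ℝ) ^ 2 :=
      Finset.sum_pos (fun j hj => by
        have : 0 < j := (Finset.mem_Icc.1 hj).1
        positivity) ⟨1, by simp; omega⟩
    rw [lintegral_incidenceCount_mul_pairBall hN, volume_maxNorm_lt_one,
      pairGaussianMass_eq (trigWeight_pos N), meanCount, ← kacRice_constant N hS]
    have hcard : (Fintype.card (Fin (N + 1) ⊕ Fin N) : ℝ) = 2 * N + 1 := by
      simp; ring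
    rw [hcard]
    set S := ∑ j ∈ Finset.Icc 1 N, (j : ℝ) ^ 2 with hSdef
    set D := Real.Gamma (2 * N + 1 + 1 / 2) * (Real.pi * (N + 1 / 2)) * (Real.pi * S) with hD
    have hD0 : 0 < D := by
      have := Real.Gamma_pos_of_pos (s := 2 * N + 1 + 1 / 2) (by positivity)
      positivity
    have hG0 : 0 < Real.Gamma (2 * N + 1 + 1) := Real.Gamma_pos_of_pos (by positivity)
    set v := volume {f : TrigCurve N | pairSq (trigWeight N) f < 1}
    have hdiv : ENNReal.ofReal (Real.Gamma (2 * N + 1 + 1)) * v / ENNReal.ofReal D =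
        ENNReal.ofReal (Real.Gamma (2 * N + 1 + 1) / D) * v := by
      rw [ENNReal.ofReal_div_of_pos hD0, ENNReal.mul_div_right_comm]
    have hprod : ∀ {a b q c : ℝ}, 0 ≤ a → 0 ≤ b → 0 ≤ q → ENNReal.ofReal (a * (b * q ^ 2 * c)) =
        ENNReal.ofReal a * (ENNReal.ofReal b * ENNReal.ofReal q ^ 2 * ENNReal.ofReal c) := by
      intro a b q c ha hb hq
      rw [ENNReal.ofReal_mul ha, ENNReal.ofReal_mul (by positivity), ENNReal.ofReal_mul hb,
        ENNReal.ofReal_pow hq]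
    rw [hdiv, hprod (by positivity) (by positivity) (by positivity)]
    ring

/-- The law of the maximal norm for the counting density is proportional to that for the volume. -/
theorem map_maxNorm_withDensity_incidenceCount :
    (volume.withDensity (incidenceCount (N := N))).map maxNorm =
      ENNReal.ofReal (meanCount N) • (volume : Measure (TrigCurve N × TrigCurve N)).map maxNorm := by
  have hcount : ∀ t : ℝ, 0 < t → ∫⁻ p in {p : TrigCurve N × TrigCurve N | maxNorm p < t},
      incidenceCount p = ENNReal.ofReal (t ^ Module.finrank ℝ (TrigCurve N × TrigCurve N)) *
        ∫⁻ p in {p : TrigCurve N × TrigCurve N | maxNorm p < 1}, incidenceCount p := fun t ht =>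
    setLIntegral_maxNorm_lt measurable_incidenceCount
      (fun r hr p => incidenceCount_smul hr.ne' p) ht
  have hvol : ∀ t : ℝ, 0 < t → volume {p : TrigCurve N × TrigCurve N | maxNorm p < t} =
      ENNReal.ofReal (t ^ Module.finrank ℝ (TrigCurve N × TrigCurve N)) *
        volume {p : TrigCurve N × TrigCurve N | maxNorm p < 1} := fun t ht => by
    have := setLIntegral_maxNorm_lt (N := N) (G := 1) measurable_one (fun r hr p => rfl) ht
    simpa using this
  have hval : ∀ t : ℝ, (volume.withDensity (incidenceCount (N := N))).map maxNorm (Iio t) =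
      ∫⁻ p in {p : TrigCurve N × TrigCurve N | maxNorm p < t}, incidenceCount p := fun t => by
    rw [Measure.map_apply measurable_maxNorm measurableSet_Iio,
      withDensity_apply _ (measurable_maxNorm measurableSet_Iio)]
    rfl
  have hempty : ∀ t : ℝ, t ≤ 0 → {p : TrigCurve N × TrigCurve N | maxNorm p < t} = ∅ :=
    fun t ht => by
      ext p
      simp only [mem_ofPred_eq, mem_empty_iff_false, iff_false, not_lt]
      exact ht.trans (maxNorm_nonneg p)
  refine Measure.ext_of_Iio_of_ne_top (fun t => ?_) fun t => ?_
  · rw [hval]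
    rcases le_or_gt t 0 with ht | ht
    · rw [hempty t ht]; simp
    · rw [hcount t ht, lintegral_incidenceCount_maxNorm_lt_one]
      exact ENNReal.mul_ne_top ENNReal.ofReal_ne_top
        (ENNReal.mul_ne_top ENNReal.ofReal_ne_top volume_maxNorm_lt_one_ne_top)
  · rw [hval, Measure.smul_apply, Measure.map_apply measurable_maxNorm measurableSet_Iio, smul_eq_mul]
    change _ = _ * volume {p : TrigCurve N × TrigCurve N | maxNorm p < t}
    rcases le_or_gt t 0 with ht | ht
    · rw [hempty t ht]; simp
    · rw [hcount t ht, lintegral_incidenceCount_maxNorm_lt_one, hvol t ht]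
      ring

/-- The count is integrable over every ball of the maximal norm, and countably many balls exhaust
the space. -/
theorem ae_incidenceCount_ne_top :
    ∀ᵐ p : TrigCurve N × TrigCurve N, incidenceCount p ≠ ∞ := by
  have h : ∀ n : ℕ, ∀ᵐ p : TrigCurve N × TrigCurve N, maxNorm p < (n : ℝ) + 1 →
      incidenceCount p ≠ ∞ := by
    intro n
    have hfin : ∫⁻ p in {p : TrigCurve N × TrigCurve N | maxNorm p < (n : ℝ) + 1},
        incidenceCount p ≠ ∞ := by
      rw [setLIntegral_maxNorm_lt measurable_incidenceCount
        (fun r hr p => incidenceCount_smul hr.ne' p) (by positivity),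
        lintegral_incidenceCount_maxNorm_lt_one]
      exact ENNReal.mul_ne_top ENNReal.ofReal_ne_top
        (ENNReal.mul_ne_top ENNReal.ofReal_ne_top volume_maxNorm_lt_one_ne_top)
    filter_upwards [(ae_restrict_iff' (measurableSet_maxNorm_lt _)).1
      (ae_lt_top measurable_incidenceCount hfin)] with p hp hlt
    exact (hp hlt).ne
  filter_upwards [ae_all_iff.2 h] with p hp
  obtain ⟨n, hn⟩ := exists_nat_gt (maxNorm p)
  exact hp n (hn.trans (lt_add_one _))

theorem finite_intersectionParams {p : TrigCurve N × TrigCurve N} (hp : incidenceCount p ≠ ∞) :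
    (intersectionParams p).Finite := by
  rw [← encard_ne_top_iff, encard_intersectionParams]
  simpa [incidenceCount] using hp

theorem toReal_incidenceCount {p : TrigCurve N × TrigCurve N} (hp : incidenceCount p ≠ ∞) :
    (incidenceCount p).toReal = (intersectionParams p).ncard := by
  rw [incidenceCount, ← encard_intersectionParams, ← (finite_intersectionParams hp).cast_ncard_eq]
  simp

/-- Constant curves that meet at one parameter pair meet at all of them, so finiteness means that
they do not meet. -/
theorem ncard_intersectionPoints_of_finite_zero {p : TrigCurve 0 × TrigCurve 0}
    (hp : (intersectionParams p).Finite) :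
    (intersectionPoints p).ncard = (intersectionParams p).ncard := by
  have hempty : intersectionParams p = ∅ := by
    by_contra hne
    obtain ⟨t, -, ht, h⟩ := nonempty_iff_ne_empty.2 hne
    have hc : ∀ φ : ℝ, p.1.eval φ = p.1.eval t.1 := fun φ => by
      ext i; simp [eval]
    have himg : ((fun φ : ℝ => (φ, t.2)) '' Ico 0 (2 * Real.pi)).Finite := by
      refine hp.subset ?_
      rintro _ ⟨φ, hφ, rfl⟩
      exact ⟨hφ, ht, (hc φ).trans h⟩
    exact (Ico_infinite Real.two_pi_pos)
      (himg.of_finite_image fun a _ b _ hab => (Prod.mk.inj hab).1)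
  simp [intersectionPoints_eq_image, hempty]

theorem ae_finite_and_ncard_eq :
    ∀ᵐ p : TrigCurve N × TrigCurve N, (intersectionParams p).Finite ∧
      (intersectionPoints p).ncard = (intersectionParams p).ncard := by
  by_cases hN : N = 0
  · subst hN
    filter_upwards [ae_incidenceCount_ne_top] with p hp
    exact ⟨finite_intersectionParams hp,
      ncard_intersectionPoints_of_finite_zero (finite_intersectionParams hp)⟩
  · filter_upwards [ae_incidenceCount_ne_top, ae_ncard_intersectionPoints hN] with p hp hp'
    exact ⟨finite_intersectionParams hp, hp'⟩

theorem lintegral_incidenceCount_maxNormLaw {h : ℝ → ℝ} (h_meas : Measurable h)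
    (h_nonneg : ∀ t : ℝ, 0 ≤ t → 0 ≤ h t)
    (h_int : Integrable (maxNormDensity N h) volume) (h_one : ∫ p, maxNormDensity N h p = 1) :
    ∫⁻ p, incidenceCount p ∂(maxNormLaw N h) = ENNReal.ofReal (meanCount N) := by
  have hd : ∀ p, maxNormDensity N h p = h (maxNorm p) := fun p => rfl
  have hone : ∫⁻ p : TrigCurve N × TrigCurve N, ENNReal.ofReal (h (maxNorm p)) = 1 := by
    rw [← ENNReal.ofReal_one, ← h_one, ofReal_integral_eq_lintegral_ofReal h_int
      (ae_of_all _ fun p => h_nonneg _ (maxNorm_nonneg p))]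
    rfl
  have hm : Measurable fun p : TrigCurve N × TrigCurve N => ENNReal.ofReal (h (maxNorm p)) :=
    ENNReal.measurable_ofReal.comp (h_meas.comp measurable_maxNorm)
  have hm' : Measurable fun t => ENNReal.ofReal (h t) := ENNReal.measurable_ofReal.comp h_meas
  rw [maxNormLaw]
  simp only [hd]
  rw [lintegral_withDensity_eq_lintegral_mul _ hm measurable_incidenceCount]
  calc ∫⁻ p : TrigCurve N × TrigCurve N, ENNReal.ofReal (h (maxNorm p)) * incidenceCount p
      -- Density and integrand exchange roles: what remains is a function of the maximal norm alone,
      -- so only the law of that norm matters.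
      = ∫⁻ p, ENNReal.ofReal (h (maxNorm p)) ∂(volume.withDensity (incidenceCount (N := N))) := by
        rw [lintegral_withDensity_eq_lintegral_mul _ measurable_incidenceCount hm, mul_comm]
        rfl
    _ = ∫⁻ t, ENNReal.ofReal (h t) ∂((volume.withDensity (incidenceCount (N := N))).map maxNorm) :=
        (lintegral_map hm' measurable_maxNorm).symm
    _ = ENNReal.ofReal (meanCount N) := by
        rw [map_maxNorm_withDensity_incidenceCount, lintegral_smul_measure,
          lintegral_map hm' measurable_maxNorm, hone, smul_eq_mul, mul_one]

end TrigCurve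

theorem corollary2 (N : ℕ) (h : ℝ → ℝ) (h_meas : Measurable h)
    (h_nonneg : ∀ t : ℝ, 0 ≤ t → 0 ≤ h t)
    (h_int : Integrable (TrigCurve.maxNormDensity N h) volume)
    (h_one : ∫ p, TrigCurve.maxNormDensity N h p = 1) :
    (∀ᵐ p ∂(TrigCurve.maxNormLaw N h),
      (TrigCurve.intersectionParams p).Finite ∧
        (TrigCurve.intersectionPoints p).ncard = (TrigCurve.intersectionParams p).ncard) ∧
    Integrable (fun p : TrigCurve N × TrigCurve N =>
      ((TrigCurve.intersectionPoints p).ncard : ℝ)) (TrigCurve.maxNormLaw N h) ∧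
    ∫ p, ((TrigCurve.intersectionPoints p).ncard : ℝ) ∂(TrigCurve.maxNormLaw N h) =
      (2 : ℝ) ^ (8 * N + 3) * (Nat.factorial (2 * N) : ℝ) ^ 4 /
        (Nat.factorial (4 * N + 1) : ℝ) ^ 2 * ∑ j ∈ Finset.Icc 1 N, (j : ℝ) ^ 2 := by
  have hac : TrigCurve.maxNormLaw N h ≪ volume := withDensity_absolutelyContinuous _ _
  have hae := hac.ae_le TrigCurve.ae_finite_and_ncard_eq
  have htop : ∀ᵐ p ∂(TrigCurve.maxNormLaw N h), TrigCurve.incidenceCount p ≠ ⊤ :=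
    hac.ae_le (TrigCurve.ae_incidenceCount_ne_top (N := N))
  have hlint := TrigCurve.lintegral_incidenceCount_maxNormLaw h_meas h_nonneg h_int h_one
  -- Both `ncard` and `toReal` give zero for an infinite count, which occurs only on a null set.
  have hcongr : (fun p : TrigCurve N × TrigCurve N => (TrigCurve.incidenceCount p).toReal)
      =ᵐ[TrigCurve.maxNormLaw N h] fun p => ((TrigCurve.intersectionPoints p).ncard : ℝ) := by
    filter_upwards [hae, htop] with p hp hp'
    rw [TrigCurve.toReal_incidenceCount hp', hp.2]
  have hpos : 0 ≤ TrigCurve.meanCount N := by unfold TrigCurve.meanCount; positivity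
  refine ⟨hae, ?_, ?_⟩
  · refine (integrable_toReal_of_lintegral_ne_top
      TrigCurve.measurable_incidenceCount.aemeasurable ?_).congr hcongr
    rw [hlint]; exact ENNReal.ofReal_ne_top
  · rw [← integral_congr_ae hcongr, integral_toReal
      TrigCurve.measurable_incidenceCount.aemeasurable (htop.mono fun p hp => hp.lt_top), hlint,
      ENNReal.toReal_ofReal hpos, TrigCurve.meanCount]
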